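/- Let $0<q<1$, and write $(z;q)_\infty=\prod_{n\ge 0}(1-zq^n)$ and $(z_1,\dots,z_k;q)_\infty=\prod_{j}(z_j;q)_\infty$. Let $a,b,c,d\in\mathbb C$ satisfy $|abcd/q^3|<1$, and let $f,g\in\mathbb C$ be non-real. Put $$F(x)=\frac{(iaq^x,-iaq^{-x},ibq^x,-ibq^{-x},icq^x,-icq^{-x},idq^x,-idq^{-x};q)_\infty\,(q^x+q^{-x})}{(fq^{-x},q^{x+1}/f,-fq^x,-q^{1-x}/f,\;gq^{-x},q^{x+1}/g,-gq^x,-q^{1-x}/g;q)_\infty},\qquad x\in\mathbb R,$$ $$V=\frac{2\pi i\,(ab/q,ac/q,ad/q,bc/q,bd/q,cd/q;q)_\infty}{f\,\log(q^{-1})\,(q,\,g/f,\,qf/g,\,-fg,\,-q/(fg),\,abcd/q^3;q)_\infty}.$$ Then the denominator of $F$ has no zero on $\mathbb R$ and $F$ is Lebesgue integrable on $\mathbb R$. If $\operatorname{Im} f$ and $\operatorname{Im} g$ have opposite signs, the denominator of $V$ is not zero. Moreover: (i) if $\operatorname{Im} f>0>\operatorname{Im} g$, then $\displaystyle\int_{-\infty}^{\infty}F(x)\,dx=V$;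 (ii) if $\operatorname{Im} f<0<\operatorname{Im} g$, then $\displaystyle\int_{-\infty}^{\infty}F(x)\,dx=-V$; (iii) if $\operatorname{Im} f$ and $\operatorname{Im} g$ have the same sign, then $\displaystyle\int_{-\infty}^{\infty}F(x)\,dx=0$. -/

import Mathlib

open MeasureTheory

/-- The infinite `q`-shifted factorial `(a; q)_∞ = ∏_{n ≥ 0} (1 - a qⁿ)`. -/
noncomputable def qPoch (q : ℝ) (a : ℂ) : ℂ :=
  ∏' n : ℕ, (1 - a * (q : ℂ) ^ n)

/-- The contracted notation `(a₁, …, a_k; q)_∞ = ∏_j (a_j; q)_∞`. -/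
noncomputable def qPochs (q : ℝ) (l : List ℂ) : ℂ :=
  (l.map (qPoch q)).prod

/-- For `0 < q < 1` the product defining `(a; q)_∞` converges, for every `a`. -/
theorem qPoch_hasProd (q : ℝ) (hq0 : 0 < q) (hq1 : q < 1) (a : ℂ) :
    HasProd (fun n : ℕ => 1 - a * (q : ℂ) ^ n) (qPoch q a) := by
  have hn : ‖(q : ℂ)‖ < 1 := by
    rw [Complex.norm_real, Real.norm_eq_abs, abs_of_pos hq0]
    exact hq1
  have hs : Summable (fun n : ℕ => ‖-(a * (q : ℂ) ^ n)‖) := by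
    simp only [norm_neg, norm_mul, norm_pow]
    exact (summable_geometric_of_lt_one (norm_nonneg _) hn).mul_left _
  have hm := multipliable_one_add_of_summable hs
  simp only [← sub_eq_add_neg] at hm
  exact hm.hasProd

/-- The integrand of the `q`-beta integral, with `X = q^x` and `Y = q^{-x}`:
`(iaX, -iaY, ibX, -ibY, icX, -icY, idX, -idY; q)_∞ (X + Y)` divided by
`(fY, qX/f, -fX, -qY/f, gY, qX/g, -gX, -qY/g; q)_∞`. -/
noncomputable def qBetaIntegrand (q : ℝ) (a b c d f g : ℂ) (x : ℝ) : ℂ :=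
  let X : ℂ := ((q ^ x : ℝ) : ℂ)
  let Y : ℂ := ((q ^ (-x) : ℝ) : ℂ)
  qPochs q
      [Complex.I * a * X, -(Complex.I * a * Y), Complex.I * b * X, -(Complex.I * b * Y),
       Complex.I * c * X, -(Complex.I * c * Y), Complex.I * d * X, -(Complex.I * d * Y)]
    * (X + Y)
    / qPochs q
      [f * Y, q * X / f, -(f * X), -(q * Y / f),
       g * Y, q * X / g, -(g * X), -(q * Y / g)]

/-- The closed form
`2πi (ab/q, ac/q, ad/q, bc/q, bd/q, cd/q; q)_∞`
divided by `f log(q⁻¹) (q, g/f, qf/g, -fg, -q/(fg), abcd/q³; q)_∞`. -/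
noncomputable def qBetaValue (q : ℝ) (a b c d f g : ℂ) : ℂ :=
  2 * Real.pi * Complex.I
      * qPochs q [a * b / q, a * c / q, a * d / q, b * c / q, b * d / q, c * d / q]
    / (f * ((Real.log q⁻¹ : ℝ) : ℂ)
      * qPochs q [(q : ℂ), g / f, q * f / g, -(f * g), -(q / (f * g)),
          a * b * c * d / (q : ℂ) ^ 3])

open Filter Topology

/-! Put X = q^x and write θ_f(X) for `qThetaPair q f X`, so that the denominator of F is θ_f θ_g.

Removing the parameters: for a suitable G (`contiguityPrimitive`) the integral of G(x) - G(x+1)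
vanishes by translation invariance, which links the integral at a to the one at aq
(`qBetaIntegral_contiguous`). Iterating, with dominated convergence as aq^N → 0, produces the
infinite products involving a; symmetry in the four parameters then leaves only the integral with a
= b = c = d = 0 (`qBetaIntegral_eq`).

The parameter-free integral: summing over the translates x + n folds it onto [0,1], and the Jacobi
triple product sums the numerator to (q, -X², -q/X²; q)_∞ / X (`tsum_qBetaKernel_zero`). The triple
product also turns θ_f(X) into a 2×2 determinant, whence a three-term relation; differentiated on
the diagonal, it shows that the Wronskian of θ_f and θ_g is a constant times the same numerator
(`wronskian_qThetaPair`). Up to that constant the folded integrand is therefore the derivative of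
log θ_g - log θ_f.

Over one period a continuous log θ_f changes by -log q ∓ πi according to the sign of Im f
(`exists_log_qThetaPair`). The difference for f and g is ±2πi when the signs are opposite and 0 when
they agree. The Wronskian constant can vanish only for equal signs; then θ_g is a multiple of θ_f,
and θ_1/θ_f is, up to a constant, a periodic antiderivative. -/

/-! ### The q-shifted factorial: recursion, zeros, analyticity, growth. -/

theorem summable_norm_neg_mul_pow {q : ℝ} (hq0 : 0 < q) (hq1 : q < 1) (a : ℂ) :
    Summable (fun n : ℕ => ‖-(a * (q : ℂ) ^ n)‖) := by
  have hn : ‖(q : ℂ)‖ < 1 := by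
    rwa [Complex.norm_real, Real.norm_eq_abs, abs_of_pos hq0]
  simp only [norm_neg, norm_mul, norm_pow]
  exact (summable_geometric_of_lt_one (norm_nonneg _) hn).mul_left _

theorem tendsto_prod_qPoch {q : ℝ} (hq0 : 0 < q) (hq1 : q < 1) (a : ℂ) :
    Tendsto (fun N => ∏ n ∈ Finset.range N, (1 - a * (q : ℂ) ^ n)) atTop (𝓝 (qPoch q a)) :=
  (qPoch_hasProd q hq0 hq1 a).tendsto_prod_nat

theorem qPoch_eq_mul {q : ℝ} (hq0 : 0 < q) (hq1 : q < 1) (a : ℂ) :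
    qPoch q a = (1 - a) * qPoch q (a * q) := by
  have h1 := (tendsto_prod_qPoch hq0 hq1 a).comp (tendsto_add_atTop_nat 1)
  have h2 := (tendsto_prod_qPoch hq0 hq1 (a * q)).const_mul (1 - a)
  refine tendsto_nhds_unique h1 (h2.congr fun N => ?_)
  simp only [Function.comp]
  rw [Finset.prod_range_succ', mul_comm]
  simp [pow_succ', mul_assoc]

theorem qPoch_eq_prod_mul {q : ℝ} (hq0 : 0 < q) (hq1 : q < 1) (a : ℂ) (N : ℕ) :
    qPoch q a = (∏ n ∈ Finset.range N, (1 - a * (q : ℂ) ^ n)) * qPoch q (a * q ^ N) := by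
  induction N with
  | zero => simp
  | succ N ih =>
    rw [ih, Finset.prod_range_succ, qPoch_eq_mul hq0 hq1 (a * q ^ N), pow_succ]
    ring_nf

theorem qPoch_zero (q : ℝ) : qPoch q 0 = 1 := by simp [qPoch]

theorem qPoch_ne_zero {q : ℝ} (hq0 : 0 < q) (hq1 : q < 1) {a : ℂ}
    (h : ∀ n : ℕ, 1 - a * (q : ℂ) ^ n ≠ 0) : qPoch q a ≠ 0 := by
  have := tprod_one_add_ne_zero_of_summable (f := fun n : ℕ => -(a * (q : ℂ) ^ n))
    (by simpa [← sub_eq_add_neg] using h) (summable_norm_neg_mul_pow hq0 hq1 a)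
  simpa [qPoch, ← sub_eq_add_neg] using this

theorem qPoch_ne_zero_of_im_ne_zero {q : ℝ} (hq0 : 0 < q) (hq1 : q < 1) {a : ℂ}
    (h : a.im ≠ 0) : qPoch q a ≠ 0 := by
  refine qPoch_ne_zero hq0 hq1 fun n h0 => ?_
  have h1 := congrArg Complex.im h0
  rw [← Complex.ofReal_pow] at h1
  simp only [Complex.sub_im, Complex.one_im, Complex.im_mul_ofReal, Complex.zero_im] at h1
  have : a.im * q ^ n = 0 := by linarith
  exact mul_ne_zero h (pow_pos hq0 n).ne' this

theorem qPoch_ne_zero_of_norm_lt_one {q : ℝ} (hq0 : 0 < q) (hq1 : q < 1) {a : ℂ}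
    (h : ‖a‖ < 1) : qPoch q a ≠ 0 := by
  refine qPoch_ne_zero hq0 hq1 fun n h0 => ?_
  have h1 : a * (q : ℂ) ^ n = 1 := (sub_eq_zero.mp h0).symm
  have h2 := congrArg norm h1
  rw [norm_mul, norm_pow, Complex.norm_real, Real.norm_eq_abs, abs_of_pos hq0, norm_one] at h2
  have h3 : q ^ n ≤ 1 := pow_le_one₀ hq0.le hq1.le
  nlinarith [norm_nonneg a, pow_pos hq0 n]

theorem differentiable_qPoch {q : ℝ} (hq0 : 0 < q) (hq1 : q < 1) :
    Differentiable ℂ (qPoch q) := by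
  have hn : ‖(q : ℂ)‖ < 1 := by
    rwa [Complex.norm_real, Real.norm_eq_abs, abs_of_pos hq0]
  intro a
  have hs : Summable (fun n : ℕ => (‖a‖ + 1) * ‖(q : ℂ)‖ ^ n) :=
    (summable_geometric_of_lt_one (norm_nonneg _) hn).mul_left _
  have ho : IsOpen (Metric.ball (0 : ℂ) (‖a‖ + 1)) := Metric.isOpen_ball
  have h := hs.hasProdLocallyUniformlyOn_nat_one_add
    (f := fun (n : ℕ) (z : ℂ) => -(z * (q : ℂ) ^ n)) ho
    (Eventually.of_forall fun n z hz => by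
      rw [norm_neg, norm_mul, norm_pow]
      gcongr
      exact (mem_ball_zero_iff.mp hz).le)
    (fun n => by fun_prop)
  have h2 := h.tendstoLocallyUniformlyOn_finsetRange.differentiableOn
    (Eventually.of_forall fun N => by fun_prop) ho
  have h3 := h2.differentiableAt (x := a) (ho.mem_nhds (by simp))
  have he : (fun z => ∏' n : ℕ, (1 + -(z * (q : ℂ) ^ n))) = qPoch q := by
    funext z
    simp [qPoch, ← sub_eq_add_neg]
  rwa [he] at h3

theorem continuous_qPoch {q : ℝ} (hq0 : 0 < q) (hq1 : q < 1) : Continuous (qPoch q) :=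
  (differentiable_qPoch hq0 hq1).continuous

theorem tendsto_qPoch_mul_pow {q : ℝ} (hq0 : 0 < q) (hq1 : q < 1) (a : ℂ) :
    Tendsto (fun N : ℕ => qPoch q (a * q ^ N)) atTop (𝓝 1) := by
  have hn : ‖(q : ℂ)‖ < 1 := by
    rwa [Complex.norm_real, Real.norm_eq_abs, abs_of_pos hq0]
  have h := (tendsto_pow_atTop_nhds_zero_of_norm_lt_one hn).const_mul a
  rw [mul_zero] at h
  have h2 := ((continuous_qPoch hq0 hq1).tendsto 0).comp h
  rwa [qPoch_zero] at h2

/-- On the disc of radius r each factor is largest at the point -r, where it equals 1 + r qⁿ. -/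
theorem norm_qPoch_le {q : ℝ} (hq0 : 0 < q) (hq1 : q < 1) {a : ℂ} {r : ℝ} (h : ‖a‖ ≤ r) :
    ‖qPoch q a‖ ≤ ‖qPoch q (-(r : ℂ))‖ := by
  have hr : 0 ≤ r := (norm_nonneg _).trans h
  refine le_of_tendsto_of_tendsto' (tendsto_prod_qPoch hq0 hq1 a).norm
    (tendsto_prod_qPoch hq0 hq1 (-(r : ℂ))).norm fun N => ?_
  rw [norm_prod, norm_prod]
  refine Finset.prod_le_prod (fun _ _ => norm_nonneg _) fun n _ => ?_
  have e : (1 : ℂ) - -(r : ℂ) * (q : ℂ) ^ n = ((1 + r * q ^ n : ℝ) : ℂ) := by push_cast; ring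
  have hp := pow_pos hq0 n
  rw [e, Complex.norm_real, Real.norm_of_nonneg (by positivity)]
  calc ‖1 - a * (q : ℂ) ^ n‖ ≤ ‖(1 : ℂ)‖ + ‖a * (q : ℂ) ^ n‖ := norm_sub_le _ _
    _ ≤ 1 + r * q ^ n := by
      rw [norm_one, norm_mul, norm_pow, Complex.norm_real, Real.norm_of_nonneg hq0.le]
      gcongr

/-! ### Theta functions and their quasi-periodicity under X ↦ qX. -/

/-- The modified theta function `(z, q/z; q)_∞`. -/
noncomputable def qTheta (q : ℝ) (z : ℂ) : ℂ := qPoch q z * qPoch q (q / z)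

theorem qTheta_mul {q : ℝ} (hq0 : 0 < q) (hq1 : q < 1) {z : ℂ} (hz : z ≠ 0) :
    z * qTheta q (z * q) = -qTheta q z := by
  have hq : (q : ℂ) ≠ 0 := by exact_mod_cast hq0.ne'
  have e1 : (q : ℂ) / (z * q) = 1 / z := by field_simp
  have e2 : 1 / z * (q : ℂ) = q / z := by ring
  rw [qTheta, qTheta, qPoch_eq_mul hq0 hq1 z, e1, qPoch_eq_mul hq0 hq1 (1 / z), e2]
  field_simp
  ring

theorem qTheta_ne_zero_of_im_ne_zero {q : ℝ} (hq0 : 0 < q) (hq1 : q < 1) {z : ℂ}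
    (h : z.im ≠ 0) : qTheta q z ≠ 0 := by
  refine mul_ne_zero (qPoch_ne_zero_of_im_ne_zero hq0 hq1 h)
    (qPoch_ne_zero_of_im_ne_zero hq0 hq1 ?_)
  rw [div_eq_mul_inv, Complex.im_ofReal_mul, Complex.inv_im]
  refine mul_ne_zero hq0.ne' (div_ne_zero (neg_ne_zero.mpr h) ?_)
  rw [Ne, Complex.normSq_eq_zero]
  rintro rfl
  simp at h

/-- The product `(f/X, qX/f, -fX, -q/(fX); q)_∞`. -/
noncomputable def qThetaPair (q : ℝ) (f X : ℂ) : ℂ := qTheta q (f / X) * qTheta q (-(f * X))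

theorem qThetaPair_mul {q : ℝ} (hq0 : 0 < q) (hq1 : q < 1) {f X : ℂ} (hf : f ≠ 0) (hX : X ≠ 0) :
    q * X ^ 2 * qThetaPair q f (X * q) = -qThetaPair q f X := by
  have hq : (q : ℂ) ≠ 0 := by exact_mod_cast hq0.ne'
  have h1 := qTheta_mul hq0 hq1 (z := f / (X * q)) (by positivity)
  have h2 := qTheta_mul hq0 hq1 (z := -(f * X)) (by simp [hf, hX])
  have e1 : f / (X * q) * q = f / X := by field_simp
  have e2 : -(f * X) * q = -(f * (X * q)) := by ring
  rw [e1] at h1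
  rw [e2] at h2
  have h3 : qTheta q (f / (X * q)) = -(f / (X * q) * qTheta q (f / X)) := by rw [h1]; ring
  have h4 : qTheta q (-(f * X)) = f * X * qTheta q (-(f * (X * q))) := by linear_combination h2
  rw [qThetaPair, qThetaPair, h3, h4]
  field_simp

theorem qThetaPair_ne_zero {q : ℝ} (hq0 : 0 < q) (hq1 : q < 1) {f : ℂ} {X : ℝ} (hf : f.im ≠ 0)
    (hX : 0 < X) : qThetaPair q f X ≠ 0 := by
  refine mul_ne_zero (qTheta_ne_zero_of_im_ne_zero hq0 hq1 ?_)
    (qTheta_ne_zero_of_im_ne_zero hq0 hq1 ?_)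
  · rw [Complex.div_ofReal_im]
    exact div_ne_zero hf hX.ne'
  · rw [Complex.neg_im, Complex.im_mul_ofReal]
    exact neg_ne_zero.mpr (mul_ne_zero hf hX.ne')

theorem qThetaPair_inv (q : ℝ) (f X : ℂ) : qThetaPair q f X⁻¹ = qThetaPair q (-f) X := by
  rw [qThetaPair, qThetaPair, mul_comm]
  congr 2 <;> simp [div_eq_mul_inv]

theorem differentiableAt_qThetaPair {q : ℝ} (hq0 : 0 < q) (hq1 : q < 1) {f X : ℂ} (hf : f ≠ 0)
    (hX : X ≠ 0) : DifferentiableAt ℂ (qThetaPair q f) X := by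
  have h := differentiable_qPoch hq0 hq1
  have h1 : DifferentiableAt ℂ (fun X => f / X) X := by fun_prop (disch := assumption)
  have h2 : DifferentiableAt ℂ (fun X => (q : ℂ) / (f / X)) X := by
    fun_prop (disch := exact div_ne_zero hf hX)
  have h3 : DifferentiableAt ℂ (fun X => -(f * X)) X := by fun_prop
  have h4 : DifferentiableAt ℂ (fun X => (q : ℂ) / (-(f * X))) X := by
    fun_prop (disch := exact neg_ne_zero.mpr (mul_ne_zero hf hX))
  have g1 := (h _).comp X h1
  have g2 := (h _).comp X h2
  have g3 := (h _).comp X h3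
  have g4 := (h _).comp X h4
  exact (g1.mul g2).mul (g3.mul g4)

/-! ### The Jacobi triple product. -/

/-- The general term `(-1)ⁿ q^(n(n-1)/2) zⁿ` of the theta series. -/
noncomputable def thetaTerm (q : ℝ) (z : ℂ) (n : ℤ) : ℂ :=
  (-1) ^ n * (q : ℂ) ^ (n * (n - 1) / 2) * z ^ n

/-- The integer division in `thetaTerm` is exact; in this linear form `lia` can compare exponents.
-/
theorem two_mul_choose_two (n : ℤ) : 2 * (n * (n - 1) / 2) = n * (n - 1) :=
  Int.mul_ediv_cancel' (Int.even_mul_pred_self n).two_dvd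

theorem thetaTerm_zero (q : ℝ) (z : ℂ) : thetaTerm q z 0 = 1 := by simp [thetaTerm]

theorem thetaTerm_ne_zero {q : ℝ} (hq0 : 0 < q) {z : ℂ} (hz : z ≠ 0) (n : ℤ) :
    thetaTerm q z n ≠ 0 := by
  have hq : (q : ℂ) ≠ 0 := by exact_mod_cast hq0.ne'
  exact mul_ne_zero (mul_ne_zero (zpow_ne_zero _ (by norm_num)) (zpow_ne_zero _ hq))
    (zpow_ne_zero _ hz)

theorem thetaTerm_succ {q : ℝ} (hq0 : 0 < q) {z : ℂ} (hz : z ≠ 0) (n : ℤ) :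
    thetaTerm q z (n + 1) = -((q : ℂ) ^ n * z * thetaTerm q z n) := by
  have hq : (q : ℂ) ≠ 0 := by exact_mod_cast hq0.ne'
  have e : (n + 1) * (n + 1 - 1) / 2 = n + n * (n - 1) / 2 := by
    have h1 := two_mul_choose_two (n + 1)
    have h2 := two_mul_choose_two n
    have h3 : (n + 1) * (n + 1 - 1) = 2 * n + n * (n - 1) := by ring
    lia
  rw [thetaTerm, thetaTerm, e, zpow_add₀ hq, zpow_add₀ hz, zpow_add₀ (by norm_num)]
  simp
  ring

theorem thetaTerm_mul (q : ℝ) (z w : ℂ) (n : ℤ) :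
    thetaTerm q (z * w) n = w ^ n * thetaTerm q z n := by
  rw [thetaTerm, thetaTerm, mul_zpow]
  ring

theorem summable_norm_thetaTerm {q : ℝ} (hq0 : 0 < q) (hq1 : q < 1) {z : ℂ} (hz : z ≠ 0) :
    Summable fun n => ‖thetaTerm q z n‖ := by
  have hq : (q : ℂ) ≠ 0 := by exact_mod_cast hq0.ne'
  have hp : Tendsto (fun n : ℕ => q ^ n) atTop (𝓝 0) :=
    tendsto_pow_atTop_nhds_zero_of_lt_one hq0.le hq1
  have hne (n : ℤ) : ‖thetaTerm q z n‖ ≠ 0 := norm_ne_zero_iff.mpr (thetaTerm_ne_zero hq0 hz n)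
  have hzn : ‖z‖ ≠ 0 := norm_ne_zero_iff.mpr hz
  have hs (n : ℤ) : ‖thetaTerm q z (n + 1)‖ = q ^ n * ‖z‖ * ‖thetaTerm q z n‖ := by
    rw [thetaTerm_succ hq0 hz, norm_neg, norm_mul, norm_mul, norm_zpow, Complex.norm_real,
      Real.norm_of_nonneg hq0.le]
  refine Summable.of_nat_of_neg_add_one ?_ ?_
  · refine summable_of_ratio_test_tendsto_lt_one zero_lt_one
      (Eventually.of_forall fun n => hne n) ?_
    have h := hp.mul_const ‖z‖
    rw [zero_mul] at h
    refine h.congr fun n => ?_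
    rw [norm_norm, norm_norm, Nat.cast_succ, hs, mul_div_cancel_right₀ _ (hne n), zpow_natCast]
  · refine summable_of_ratio_test_tendsto_lt_one zero_lt_one
      (Eventually.of_forall fun n => hne _) ?_
    have h := (hp.const_mul (q ^ 2)).mul_const ‖z‖⁻¹
    rw [mul_zero, zero_mul] at h
    refine h.congr fun n => ?_
    have h1 := hs (-((n : ℤ) + 1 + 1))
    rw [show -((n : ℤ) + 1 + 1) + 1 = -((n : ℤ) + 1) by ring] at h1
    have hqz : q ^ (-((n : ℤ) + 1 + 1)) = (q ^ 2 * q ^ n)⁻¹ := by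
      rw [zpow_neg, ← pow_add, ← zpow_natCast]
      congr 2
      push_cast
      ring
    rw [norm_norm, norm_norm, Nat.cast_succ, h1, hqz]
    have := hne (-((n : ℤ) + 1 + 1))
    field_simp

theorem qPoch_zpow {q : ℝ} (hq0 : 0 < q) (hq1 : q < 1) (k : ℤ) :
    qPoch q ((q : ℂ) ^ k) = (1 - (q : ℂ) ^ k) * qPoch q ((q : ℂ) ^ (k + 1)) := by
  have hq : (q : ℂ) ≠ 0 := by exact_mod_cast hq0.ne'
  rw [qPoch_eq_mul hq0 hq1, zpow_add_one₀ hq]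

theorem qPoch_zpow_of_nonpos {q : ℝ} (hq0 : 0 < q) (hq1 : q < 1) {k : ℤ} (hk : k ≤ 0) :
    qPoch q ((q : ℂ) ^ k) = 0 := by
  induction k, hk using Int.leInductionDown with
  | base => rw [qPoch_zpow hq0 hq1]; simp
  | pred n _ ih => rw [qPoch_zpow hq0 hq1, sub_add_cancel, ih, mul_zero]

theorem norm_qPoch_zpow_le_one {q : ℝ} (hq0 : 0 < q) (hq1 : q < 1) (k : ℤ) :
    ‖qPoch q ((q : ℂ) ^ k)‖ ≤ 1 := by
  rcases le_or_gt k 0 with hk | hk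
  · simp [qPoch_zpow_of_nonpos hq0 hq1 hk]
  · lift k to ℕ using hk.le
    refine le_of_tendsto' (tendsto_prod_qPoch hq0 hq1 _).norm fun N => ?_
    rw [norm_prod]
    refine Finset.prod_le_one (fun _ _ => norm_nonneg _) fun n _ => ?_
    have e : (1 : ℂ) - (q : ℂ) ^ (k : ℤ) * (q : ℂ) ^ n = ((1 - q ^ (k + n) : ℝ) : ℂ) := by
      push_cast
      rw [zpow_natCast, pow_add]
    have h1 : q ^ (k + n) ≤ 1 := pow_le_one₀ hq0.le hq1.le
    have h2 := pow_pos hq0 (k + n)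
    rw [e, Complex.norm_real, Real.norm_of_nonneg (by linarith)]
    linarith

/-- The theta series with `n`-th term weighted by `(q^(n+N+1); q)_∞`. -/
noncomputable def weightedTheta (q : ℝ) (N : ℕ) (z : ℂ) : ℂ :=
  ∑' n : ℤ, thetaTerm q z n * qPoch q ((q : ℂ) ^ (n + N + 1))

theorem summable_weightedTheta {q : ℝ} (hq0 : 0 < q) (hq1 : q < 1) {z : ℂ} (hz : z ≠ 0)
    (k : ℤ → ℤ) : Summable fun n => thetaTerm q z n * qPoch q ((q : ℂ) ^ k n) := by
  refine Summable.of_norm_bounded (summable_norm_thetaTerm hq0 hq1 hz) fun n => ?_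
  rw [norm_mul]
  exact mul_le_of_le_one_right (norm_nonneg _) (norm_qPoch_zpow_le_one hq0 hq1 _)

/-- The weights interpolate between N = 0, where all terms with n < 0 vanish, and N → ∞, where every
weight tends to 1. Each step in N contributes one factor of (q/z; q)_∞. -/
theorem weightedTheta_succ {q : ℝ} (hq0 : 0 < q) (hq1 : q < 1) {z : ℂ} (hz : z ≠ 0) (N : ℕ) :
    weightedTheta q (N + 1) z = (1 - q / z * q ^ N) * weightedTheta q N z := by
  have hq : (q : ℂ) ≠ 0 := by exact_mod_cast hq0.ne'
  have h1 : weightedTheta q N z = weightedTheta q (N + 1) z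
      + q / z * q ^ N * ∑' n : ℤ, thetaTerm q z (n + 1) * qPoch q ((q : ℂ) ^ (n + 1 + N + 1)) := by
    rw [weightedTheta, weightedTheta, ← tsum_mul_left, ← Summable.tsum_add]
    · refine tsum_congr fun n => ?_
      rw [qPoch_zpow hq0 hq1, thetaTerm_succ hq0 hz,
        show n + ((N + 1 : ℕ) : ℤ) + 1 = n + N + 1 + 1 by push_cast; ring,
        show n + 1 + (N : ℤ) + 1 = n + N + 1 + 1 by ring,
        show (q : ℂ) ^ (n + (N : ℤ) + 1) = q ^ n * q ^ N * q by
          rw [zpow_add_one₀ hq, zpow_add₀ hq, zpow_natCast]]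
      field_simp
      ring
    · exact summable_weightedTheta hq0 hq1 hz _
    · refine Summable.mul_left _ ?_
      exact ((Equiv.addRight (1 : ℤ)).summable_iff (f := fun n : ℤ =>
        thetaTerm q z n * qPoch q ((q : ℂ) ^ (n + N + 1)))).mpr
          (summable_weightedTheta hq0 hq1 hz _)
  have h2 : ∑' n : ℤ, thetaTerm q z (n + 1) * qPoch q ((q : ℂ) ^ (n + 1 + N + 1))
      = weightedTheta q N z :=
    (Equiv.addRight (1 : ℤ)).tsum_eq (fun n : ℤ =>
        thetaTerm q z n * qPoch q ((q : ℂ) ^ (n + N + 1)))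
  rw [h2] at h1
  linear_combination -h1

theorem weightedTheta_zero_eq_mul {q : ℝ} (hq0 : 0 < q) (hq1 : q < 1) {z : ℂ} (hz : z ≠ 0) :
    weightedTheta q 0 z = (1 - z) * weightedTheta q 0 (z * q) := by
  have hq : (q : ℂ) ≠ 0 := by exact_mod_cast hq0.ne'
  have h2 : ∑' n : ℤ, thetaTerm q z (n + 1) * qPoch q ((q : ℂ) ^ (n + 1))
      = ∑' n : ℤ, thetaTerm q z n * qPoch q ((q : ℂ) ^ n) :=
    (Equiv.addRight (1 : ℤ)).tsum_eq (fun n : ℤ => thetaTerm q z n * qPoch q ((q : ℂ) ^ n))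
  have h3 : z * weightedTheta q 0 (z * q)
      = -∑' n : ℤ, thetaTerm q z n * qPoch q ((q : ℂ) ^ n) := by
    rw [← h2, weightedTheta, ← tsum_mul_left, ← tsum_neg]
    refine tsum_congr fun n => ?_
    rw [thetaTerm_mul, thetaTerm_succ hq0 hz]
    simp
    ring
  have h4 : weightedTheta q 0 (z * q) + ∑' n : ℤ, thetaTerm q z n * qPoch q ((q : ℂ) ^ n)
      = weightedTheta q 0 z := by
    rw [weightedTheta, weightedTheta, ← Summable.tsum_add]
    · refine tsum_congr fun n => ?_
      rw [thetaTerm_mul, qPoch_zpow hq0 hq1 n]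
      simp
      ring
    · exact summable_weightedTheta hq0 hq1 (mul_ne_zero hz hq) _
    · exact summable_weightedTheta hq0 hq1 hz _
  linear_combination -h4 + h3

/-- By `weightedTheta_zero_eq_mul` both sides obey the same recursion under z ↦ zq. Along z q^N → 0
only the term n = 0 survives, and it equals (q; q)_∞. -/
theorem weightedTheta_zero {q : ℝ} (hq0 : 0 < q) (hq1 : q < 1) {z : ℂ} (hz : z ≠ 0) :
    weightedTheta q 0 z = qPoch q q * qPoch q z := by
  have hq : (q : ℂ) ≠ 0 := by exact_mod_cast hq0.ne'
  have hn : ‖(q : ℂ)‖ < 1 := by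
    rwa [Complex.norm_real, Real.norm_eq_abs, abs_of_pos hq0]
  have h1 (N : ℕ) : weightedTheta q 0 z
      = (∏ n ∈ Finset.range N, (1 - z * (q : ℂ) ^ n)) * weightedTheta q 0 (z * q ^ N) := by
    induction N with
    | zero => simp
    | succ N ih =>
      rw [ih, Finset.prod_range_succ,
        weightedTheta_zero_eq_mul hq0 hq1 (mul_ne_zero hz (pow_ne_zero N hq)), pow_succ]
      ring_nf
  have h2 : Tendsto (fun N : ℕ => weightedTheta q 0 (z * q ^ N)) atTop
      (𝓝 (∑' n : ℤ, if n = 0 then qPoch q q else 0)) := by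
    refine tendsto_tsum_of_dominated_convergence (summable_norm_thetaTerm hq0 hq1 hz) ?_
      (Eventually.of_forall fun N n => ?_)
    · intro n
      rcases lt_trichotomy n 0 with hneg | rfl | hpos
      · rw [if_neg hneg.ne, qPoch_zpow_of_nonpos hq0 hq1 (by simp; lia)]
        simp
      · simp [thetaTerm_zero]
      · rw [if_neg hpos.ne']
        lift n to ℕ using hpos.le
        have hn0 : n ≠ 0 := by rintro rfl; simp at hpos
        have h3 : Tendsto (fun N : ℕ => ((q : ℂ) ^ N) ^ n) atTop (𝓝 0) := by
          simpa [hn0] using (tendsto_pow_atTop_nhds_zero_of_norm_lt_one hn).pow n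
        have h4 := (h3.mul_const (thetaTerm q z n)).mul_const
          (qPoch q ((q : ℂ) ^ ((n : ℤ) + (0 : ℕ) + 1)))
        simp only [zero_mul] at h4
        refine h4.congr fun N => ?_
        rw [thetaTerm_mul, zpow_natCast]
    -- The terms with n < 0 have weight zero, so (q^N)ⁿ occurs only with n ≥ 0 and the series at z
    -- dominates for all N.
    · rcases lt_or_ge n 0 with hneg | hpos
      · rw [qPoch_zpow_of_nonpos hq0 hq1 (by simp; lia)]
        simp
      · lift n to ℕ using hpos
        rw [thetaTerm_mul, norm_mul, norm_mul, zpow_natCast, norm_pow, norm_pow]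
        have h5 : (‖(q : ℂ)‖ ^ N) ^ n ≤ 1 :=
          pow_le_one₀ (by positivity) (pow_le_one₀ (by positivity) hn.le)
        calc _ ≤ 1 * ‖thetaTerm q z n‖ * 1 := by
              gcongr
              exact norm_qPoch_zpow_le_one hq0 hq1 _
          _ = _ := by ring
  rw [tsum_ite_eq] at h2
  have h3 := (tendsto_prod_qPoch hq0 hq1 z).mul h2
  rw [mul_comm (qPoch q q)]
  refine tendsto_nhds_unique (tendsto_const_nhds.congr h1) h3

/-- The Jacobi triple product identity. -/
theorem hasSum_thetaTerm {q : ℝ} (hq0 : 0 < q) (hq1 : q < 1) {z : ℂ} (hz : z ≠ 0) :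
    HasSum (thetaTerm q z) (qPoch q q * qTheta q z) := by
  have hq : (q : ℂ) ≠ 0 := by exact_mod_cast hq0.ne'
  have h1 (N : ℕ) : weightedTheta q N z
      = (∏ n ∈ Finset.range N, (1 - q / z * (q : ℂ) ^ n)) * weightedTheta q 0 z := by
    induction N with
    | zero => simp
    | succ N ih =>
      rw [weightedTheta_succ hq0 hq1 hz, ih, Finset.prod_range_succ]
      ring
  have h2 : Tendsto (fun N : ℕ => weightedTheta q N z) atTop (𝓝 (∑' n, thetaTerm q z n)) := by
    refine tendsto_tsum_of_dominated_convergence (summable_norm_thetaTerm hq0 hq1 hz) ?_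
      (Eventually.of_forall fun N n => ?_)
    · intro n
      have h4 := ((tendsto_qPoch_mul_pow hq0 hq1 ((q : ℂ) ^ (n + 1))).const_mul (thetaTerm q z n))
      rw [mul_one] at h4
      refine h4.congr fun N => ?_
      rw [add_right_comm, zpow_add₀ hq (n + 1), zpow_natCast]
    · rw [norm_mul]
      exact mul_le_of_le_one_right (norm_nonneg _) (norm_qPoch_zpow_le_one hq0 hq1 _)
  have h3 := ((tendsto_prod_qPoch hq0 hq1 (q / z)).mul_const (weightedTheta q 0 z)).congr
    fun N => (h1 N).symm
  have h4 := tendsto_nhds_unique h2 h3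
  rw [weightedTheta_zero hq0 hq1 hz] at h4
  have h5 := (summable_norm_thetaTerm hq0 hq1 hz).of_norm.hasSum
  rw [h4] at h5
  have h6 : qPoch q q * qTheta q z = qPoch q (q / z) * (qPoch q q * qPoch q z) := by
    rw [qTheta]
    ring
  rwa [h6]

/-! ### The theta pairing as a determinant, and the three-term relation. -/

theorem tsum_int_even_add_odd {f : ℤ → ℂ} (hf : Summable f) :
    ∑' n, f n = ∑' n, f (2 * n) + ∑' n, f (2 * n + 1) := by
  have i1 : Function.Injective fun n : ℤ => 2 * n := fun a b h => by simpa using h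
  have i2 : Function.Injective fun n : ℤ => 2 * n + 1 := fun a b h => by simpa using h
  have hc : IsCompl (Set.range fun n : ℤ => 2 * n) (Set.range fun n : ℤ => 2 * n + 1) := by
    have e1 : Set.range (fun n : ℤ => 2 * n) = {n | Even n} := by
      ext n
      simp [even_iff_exists_two_mul]
    have e2 : Set.range (fun n : ℤ => 2 * n + 1) = {n | Odd n} := by
      ext n
      simp [Odd]
    rw [e1, e2]
    exact Int.isCompl_even_odd
  have h := HasSum.add_isCompl hc (i1.hasSum_range_iff.mpr (hf.comp_injective i1).hasSum)
    (i2.hasSum_range_iff.mpr (hf.comp_injective i2).hasSum)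
  exact h.tsum_eq

/-- The even part `∑ (-1)ᵐ q^(m²) X^(2m)` of the theta pairing. -/
noncomputable def thetaEven (q : ℝ) (X : ℂ) : ℂ :=
  ∑' m : ℤ, (-1) ^ m * (q : ℂ) ^ (m ^ 2) * X ^ (2 * m)

/-- The odd part `∑ (-1)ᵐ q^(m²+m) X^(2m+1)` of the theta pairing. -/
noncomputable def thetaOdd (q : ℝ) (X : ℂ) : ℂ :=
  ∑' m : ℤ, (-1) ^ m * (q : ℂ) ^ (m ^ 2 + m) * X ^ (2 * m + 1)

theorem thetaTerm_mul_thetaTerm_even {q : ℝ} (hq0 : 0 < q) {f X : ℂ} (hf : f ≠ 0) (hX : X ≠ 0)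
    (l m : ℤ) : thetaTerm q (f / X) (l + 1 - m) * thetaTerm q (-(f * X)) (l + 1 + m)
      = (-1) ^ m * (q : ℂ) ^ (m ^ 2) * X ^ (2 * m)
        * (-f * ((-1) ^ l * (q : ℂ) ^ (l ^ 2 + l) * f ^ (2 * l + 1))) := by
  have hq : (q : ℂ) ≠ 0 := by exact_mod_cast hq0.ne'
  have e : (l + 1 - m) * (l + 1 - m - 1) / 2 + (l + 1 + m) * (l + 1 + m - 1) / 2
      = m ^ 2 + (l ^ 2 + l) := by
    have h1 := two_mul_choose_two (l + 1 - m)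
    have h2 := two_mul_choose_two (l + 1 + m)
    have h3 : (l + 1 - m) * (l + 1 - m - 1) + (l + 1 + m) * (l + 1 + m - 1)
      = 2 * (m ^ 2 + (l ^ 2 + l)) := by ring
    lia
  have hm1 : (-1 : ℂ) ≠ 0 := by norm_num
  have s : (-1 : ℂ) ^ (l + 1 - m) = -((-1) ^ l * (-1) ^ m) := by
    rw [zpow_sub₀ hm1, zpow_add_one₀ hm1]
    rcases Int.even_or_odd m with h | h <;> simp [h.neg_one_zpow]
  have s2 : (-1 : ℂ) ^ (l + 1 + m) * (-1) ^ (l + 1 + m) = 1 := by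
    rw [← mul_zpow]; simp
  have t : (f / X) ^ (l + 1 - m) * (f * X) ^ (l + 1 + m) = f * f ^ (2 * l + 1) * X ^ (2 * m) := by
    have h1 : f ^ (l + 1 - m) * f ^ (l + 1 + m) = f * f ^ (2 * l + 1) := by
      rw [← zpow_add₀ hf, ← zpow_one_add₀ hf]
      ring_nf
    have h2 : X ^ (l + 1 + m) = X ^ (2 * m) * X ^ (l + 1 - m) := by
      rw [← zpow_add₀ hX]
      ring_nf
    rw [div_zpow, mul_zpow, div_mul_eq_mul_div, div_eq_iff (zpow_ne_zero _ hX), ← mul_assoc, h1,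
      h2, mul_assoc (f * _)]
  rw [thetaTerm, thetaTerm, ← neg_one_mul (f * X), mul_zpow (-1)]
  calc _ = (-1 : ℂ) ^ (l + 1 - m) * ((-1 : ℂ) ^ (l + 1 + m) * (-1) ^ (l + 1 + m))
        * ((q : ℂ) ^ ((l + 1 - m) * (l + 1 - m - 1) / 2)
          * (q : ℂ) ^ ((l + 1 + m) * (l + 1 + m - 1) / 2))
        * ((f / X) ^ (l + 1 - m) * (f * X) ^ (l + 1 + m)) := by ring
    _ = _ := by
      rw [s, s2, t, ← zpow_add₀ hq, e, zpow_add₀ hq]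
      ring

theorem thetaTerm_mul_thetaTerm_odd {q : ℝ} (hq0 : 0 < q) {f X : ℂ} (hf : f ≠ 0) (hX : X ≠ 0)
    (l m : ℤ) : thetaTerm q (f / X) (l - m) * thetaTerm q (-(f * X)) (l + m + 1)
      = (-1) ^ m * (q : ℂ) ^ (m ^ 2 + m) * X ^ (2 * m + 1)
        * (f * ((-1) ^ l * (q : ℂ) ^ (l ^ 2) * f ^ (2 * l))) := by
  have hq : (q : ℂ) ≠ 0 := by exact_mod_cast hq0.ne'
  have e : (l - m) * (l - m - 1) / 2 + (l + m + 1) * (l + m + 1 - 1) / 2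
      = m ^ 2 + m + l ^ 2 := by
    have h1 := two_mul_choose_two (l - m)
    have h2 := two_mul_choose_two (l + m + 1)
    have h3 : (l - m) * (l - m - 1) + (l + m + 1) * (l + m + 1 - 1)
      = 2 * (m ^ 2 + m + l ^ 2) := by ring
    lia
  have hm1 : (-1 : ℂ) ≠ 0 := by norm_num
  have s : (-1 : ℂ) ^ (l - m) = (-1) ^ l * (-1) ^ m := by
    rw [zpow_sub₀ hm1]
    rcases Int.even_or_odd m with h | h <;> simp [h.neg_one_zpow, div_neg]
  have s2 : (-1 : ℂ) ^ (l + m + 1) * (-1) ^ (l + m + 1) = 1 := by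
    rw [← mul_zpow]; simp
  have t : (f / X) ^ (l - m) * (f * X) ^ (l + m + 1) = f * f ^ (2 * l) * X ^ (2 * m + 1) := by
    have h1 : f ^ (l - m) * f ^ (l + m + 1) = f * f ^ (2 * l) := by
      rw [← zpow_add₀ hf, ← zpow_one_add₀ hf]
      ring_nf
    have h2 : X ^ (l + m + 1) = X ^ (2 * m + 1) * X ^ (l - m) := by
      rw [← zpow_add₀ hX]
      ring_nf
    rw [div_zpow, mul_zpow, div_mul_eq_mul_div, div_eq_iff (zpow_ne_zero _ hX), ← mul_assoc, h1,
      h2, mul_assoc (f * _)]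
  rw [thetaTerm, thetaTerm, ← neg_one_mul (f * X), mul_zpow (-1)]
  calc _ = (-1 : ℂ) ^ (l - m) * ((-1 : ℂ) ^ (l + m + 1) * (-1) ^ (l + m + 1))
        * ((q : ℂ) ^ ((l - m) * (l - m - 1) / 2)
          * (q : ℂ) ^ ((l + m + 1) * (l + m + 1 - 1) / 2))
        * ((f / X) ^ (l - m) * (f * X) ^ (l + m + 1)) := by ring
    _ = _ := by
      rw [s, s2, t, ← zpow_add₀ hq, e, zpow_add₀ hq]
      ring

/-- Multiply the triple products for f/X and -fX and group the double series by the difference n of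
the two indices. For n of fixed parity, a shift of the remaining index separates the powers of f
from those of X, so the pairing is f times a determinant in the vectors (`thetaEven`, `thetaOdd`) at
f and X. -/
theorem qThetaPair_eq {q : ℝ} (hq0 : 0 < q) (hq1 : q < 1) {f X : ℂ} (hf : f ≠ 0) (hX : X ≠ 0) :
    qPoch q q ^ 2 * qThetaPair q f X
      = f * (thetaEven q f * thetaOdd q X - thetaOdd q f * thetaEven q X) := by
  have z1 : f / X ≠ 0 := div_ne_zero hf hX
  have z2 : -(f * X) ≠ 0 := neg_ne_zero.mpr (mul_ne_zero hf hX)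
  have n1 := summable_norm_thetaTerm hq0 hq1 z1
  have n2 := summable_norm_thetaTerm hq0 hq1 z2
  have hs := summable_mul_of_summable_norm n1 n2
  let e : ℤ × ℤ ≃ ℤ × ℤ :=
    { toFun := fun p => (p.2, p.2 + p.1)
      invFun := fun p => (p.2 - p.1, p.1)
      left_inv := fun p => by ext <;> simp
      right_inv := fun p => by ext <;> simp }
  have hs2 : Summable fun p : ℤ × ℤ =>
      thetaTerm q (f / X) p.2 * thetaTerm q (-(f * X)) (p.2 + p.1) := e.summable_iff.mpr hs
  have h1 : qPoch q q ^ 2 * qThetaPair q f X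
      = ∑' n, ∑' j, thetaTerm q (f / X) j * thetaTerm q (-(f * X)) (j + n) := by
    have h2 := e.tsum_eq fun p : ℤ × ℤ => thetaTerm q (f / X) p.1 * thetaTerm q (-(f * X)) p.2
    have h3 := tsum_mul_tsum_of_summable_norm n1 n2
    rw [(hasSum_thetaTerm hq0 hq1 z1).tsum_eq, (hasSum_thetaTerm hq0 hq1 z2).tsum_eq, ← h2] at h3
    rw [← hs2.tsum_prod]
    simp only [e, Equiv.coe_fn_mk] at h3
    rw [← h3, qThetaPair]
    ring
  have hs3 : Summable fun n : ℤ =>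
      ∑' j, thetaTerm q (f / X) j * thetaTerm q (-(f * X)) (j + n) := hs2.prod
  rw [h1, tsum_int_even_add_odd hs3]
  have he (m : ℤ) : ∑' j, thetaTerm q (f / X) j * thetaTerm q (-(f * X)) (j + 2 * m)
      = (-1) ^ m * (q : ℂ) ^ (m ^ 2) * X ^ (2 * m) * (-f * thetaOdd q f) := by
    rw [thetaOdd, ← tsum_mul_left, ← tsum_mul_left, ← (Equiv.addRight (1 - m)).tsum_eq]
    refine tsum_congr fun l => ?_
    rw [← thetaTerm_mul_thetaTerm_even hq0 hf hX]
    simp only [Equiv.coe_addRight]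
    ring_nf
  have ho (m : ℤ) : ∑' j, thetaTerm q (f / X) j * thetaTerm q (-(f * X)) (j + (2 * m + 1))
      = (-1) ^ m * (q : ℂ) ^ (m ^ 2 + m) * X ^ (2 * m + 1) * (f * thetaEven q f) := by
    rw [thetaEven, ← tsum_mul_left, ← tsum_mul_left, ← (Equiv.addRight (-m)).tsum_eq]
    refine tsum_congr fun l => ?_
    rw [← thetaTerm_mul_thetaTerm_odd hq0 hf hX]
    simp only [Equiv.coe_addRight]
    ring_nf
  simp_rw [he, ho]
  rw [tsum_mul_right, tsum_mul_right, ← thetaEven, ← thetaOdd]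
  ring

theorem qPoch_self_ne_zero {q : ℝ} (hq0 : 0 < q) (hq1 : q < 1) : qPoch q q ≠ 0 :=
  qPoch_ne_zero_of_norm_lt_one hq0 hq1
    (by rwa [Complex.norm_real, Real.norm_eq_abs, abs_of_pos hq0])

/-- The three-term relation for `qThetaPair`. -/
theorem qThetaPair_three_term {q : ℝ} (hq0 : 0 < q) (hq1 : q < 1) {f g X Z : ℂ} (hf : f ≠ 0)
    (hg : g ≠ 0) (hX : X ≠ 0) (hZ : Z ≠ 0) :
    qThetaPair q f X * qThetaPair q g Z - qThetaPair q g X * qThetaPair q f Z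
      = -(f / X * qThetaPair q g f * qThetaPair q X Z) := by
  have h0 := qPoch_self_ne_zero hq0 hq1
  have h1 := qThetaPair_eq hq0 hq1 hf hX
  have h2 := qThetaPair_eq hq0 hq1 hf hZ
  have h3 := qThetaPair_eq hq0 hq1 hg hX
  have h4 := qThetaPair_eq hq0 hq1 hg hZ
  have h5 := qThetaPair_eq hq0 hq1 hg hf
  have h6 := qThetaPair_eq hq0 hq1 hX hZ
  have h7 {u v : ℂ} (h : qPoch q q ^ 2 * u = v) : u = v / qPoch q q ^ 2 := by
    rw [eq_div_iff (pow_ne_zero 2 h0), mul_comm, h]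
  -- What remains is the Plücker relation between four vectors in the plane; f/X balances the
  -- prefactors of the determinants.
  rw [h7 h1, h7 h2, h7 h3, h7 h4, h7 h5, h7 h6]
  field_simp
  ring

/-! ### The Wronskian of two theta pairings. -/

theorem hasDerivAt_ofReal_rpow {q : ℝ} (hq0 : 0 < q) (x : ℝ) :
    HasDerivAt (fun y : ℝ => ((q ^ y : ℝ) : ℂ)) (((Real.log q : ℝ) : ℂ) * ((q ^ x : ℝ) : ℂ)) x := by
  have h := (Real.hasStrictDerivAt_const_rpow hq0 x).hasDerivAt.ofReal_comp
  convert h using 1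
  push_cast
  ring

theorem differentiableAt_qThetaPair_rpow {q : ℝ} (hq0 : 0 < q) (hq1 : q < 1) {f : ℂ} (hf : f ≠ 0)
    (x : ℝ) : DifferentiableAt ℝ (fun y : ℝ => qThetaPair q f ((q ^ y : ℝ) : ℂ)) x := by
  have hX : ((q ^ x : ℝ) : ℂ) ≠ 0 := by exact_mod_cast (Real.rpow_pos_of_pos hq0 x).ne'
  exact ((differentiableAt_qThetaPair hq0 hq1 hf hX).hasDerivAt.comp_of_eq x
    (hasDerivAt_ofReal_rpow hq0 x) rfl).differentiableAt

/-- Differentiate the three-term relation in Z = q^y at Z = X. Its right side contains the factor 1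
- X/Z, which vanishes there, so only the value at X of the cofactor `R` is needed and no derivative
of a theta function. -/
theorem wronskian_qThetaPair {q : ℝ} (hq0 : 0 < q) (hq1 : q < 1) {f g : ℂ} (hf : f ≠ 0)
    (hg : g ≠ 0) (x : ℝ) :
    qThetaPair q f ((q ^ x : ℝ) : ℂ) * deriv (fun y : ℝ => qThetaPair q g ((q ^ y : ℝ) : ℂ)) x
      - qThetaPair q g ((q ^ x : ℝ) : ℂ) * deriv (fun y : ℝ => qThetaPair q f ((q ^ y : ℝ) : ℂ)) x
      = -(f * ((Real.log q : ℝ) : ℂ) * qPoch q q * qThetaPair q g f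
        * (qPoch q q * qTheta q (-((q ^ x : ℝ) : ℂ) ^ 2) / ((q ^ x : ℝ) : ℂ))) := by
  have hY (y : ℝ) : ((q ^ y : ℝ) : ℂ) ≠ 0 := by exact_mod_cast (Real.rpow_pos_of_pos hq0 y).ne'
  set X : ℂ := ((q ^ x : ℝ) : ℂ) with hXd
  have hX : X ≠ 0 := hY x
  have hc := differentiable_qPoch hq0 hq1
  have hf' := (differentiableAt_qThetaPair_rpow hq0 hq1 hf x).hasDerivAt
  have hg' := (differentiableAt_qThetaPair_rpow hq0 hq1 hg x).hasDerivAt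
  have hl := (hg'.const_mul (qThetaPair q f X)).sub (hf'.const_mul (qThetaPair q g X))
  let R : ℂ → ℂ := fun Z =>
    qPoch q (X / Z * q) * qPoch q (q / (X / Z)) * qTheta q (-(X * Z))
  have hR : DifferentiableAt ℂ R X := by
    have h1 : DifferentiableAt ℂ (fun Z => X / Z * q) X := by fun_prop (disch := assumption)
    have h2 : DifferentiableAt ℂ (fun Z => (q : ℂ) / (X / Z)) X := by
      fun_prop (disch := exact div_ne_zero hX hX)
    have h3 : DifferentiableAt ℂ (fun Z => -(X * Z)) X := by fun_prop
    have h4 : DifferentiableAt ℂ (fun Z => (q : ℂ) / (-(X * Z))) X := by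
      fun_prop (disch := exact neg_ne_zero.mpr (mul_ne_zero hX hX))
    exact (((hc _).comp X h1).mul ((hc _).comp X h2)).mul
      (((hc _).comp X h3).mul ((hc _).comp X h4))
  have hR2 : HasDerivAt (fun y : ℝ => R ((q ^ y : ℝ) : ℂ))
      (deriv R X * (((Real.log q : ℝ) : ℂ) * X)) x :=
    hR.hasDerivAt.comp_of_eq x (hasDerivAt_ofReal_rpow hq0 x) rfl
  have hL : HasDerivAt (fun y : ℝ => 1 - X / ((q ^ y : ℝ) : ℂ)) ((Real.log q : ℝ) : ℂ) x := by
    have h := ((hasDerivAt_ofReal_rpow hq0 x).fun_inv (hY x)).const_mul X |>.const_sub 1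
    simp only [← div_eq_mul_inv] at h
    refine h.congr_deriv ?_
    rw [← hXd]
    field_simp
  have hr := (hL.mul hR2).const_mul (-(f / X * qThetaPair q g f))
  have he : (fun y : ℝ => qThetaPair q f X * qThetaPair q g ((q ^ y : ℝ) : ℂ)
      - qThetaPair q g X * qThetaPair q f ((q ^ y : ℝ) : ℂ))
      = fun y : ℝ => -(f / X * qThetaPair q g f)
        * ((1 - X / ((q ^ y : ℝ) : ℂ)) * R ((q ^ y : ℝ) : ℂ)) := by
    funext y
    have hXZ : qThetaPair q X ((q ^ y : ℝ) : ℂ)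
        = (1 - X / ((q ^ y : ℝ) : ℂ)) * R ((q ^ y : ℝ) : ℂ) := by
      rw [qThetaPair, qTheta, qPoch_eq_mul hq0 hq1 (X / ((q ^ y : ℝ) : ℂ))]
      simp only [R]
      ring
    rw [qThetaPair_three_term hq0 hq1 hf hg hX (hY y), hXZ]
    ring
  have h := hl.unique (he ▸ hr)
  rw [h]
  simp only [R, ← hXd, div_self hX, one_mul, sub_self, zero_mul, add_zero, div_one]
  rw [show -(X * X) = -X ^ 2 by ring]
  field_simp

/-! ### An integrable majorant. -/

theorem isBigO_exp_of_shift_le {u : ℝ → ℝ} (hu : Continuous u) (hpos : ∀ x, 0 ≤ u x) {r : ℝ}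
    (hr : 0 < r) (hr1 : r < 1) (h : ∀ᶠ x in atTop, u (x + 1) ≤ r * u x) :
    u =O[atTop] fun x => Real.exp (-(-Real.log r) * x) := by
  obtain ⟨x₀, h0⟩ := eventually_atTop.mp h
  obtain ⟨C, hC⟩ := (isCompact_Icc (a := x₀) (b := x₀ + 1)).exists_bound_of_continuousOn
    hu.continuousOn
  have hn (n : ℕ) (y : ℝ) (hy : x₀ ≤ y) : u (y + n) ≤ r ^ n * u y := by
    induction n with
    | zero => simp
    | succ n ih =>
      have h1 := h0 (y + n) (hy.trans (by simp))
      push_cast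
      rw [← add_assoc, pow_succ']
      calc _ ≤ r * u (y + n) := h1
        _ ≤ r * (r ^ n * u y) := by gcongr
        _ = _ := by ring
  have hC0 : 0 ≤ C := (norm_nonneg _).trans (hC x₀ (by simp))
  -- `C` bounds u on [x₀, x₀ + 1]. Descending from x to that interval takes n = ⌊x - x₀⌋ steps, and
  -- n > x - x₀ - 1 accounts for the factor `r ^ (-x₀ - 1)`.
  refine Asymptotics.IsBigO.of_bound (C * r ^ (-x₀ - 1)) ?_
  filter_upwards [eventually_ge_atTop x₀] with x hx
  have hk1 := Nat.floor_le (sub_nonneg.mpr hx)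
  have hk2 := Nat.lt_floor_add_one (x - x₀)
  set n := ⌊x - x₀⌋₊
  have h1 := hn n (x - n) (by linarith)
  have h2 := hC (x - n) ⟨by linarith, by linarith⟩
  rw [sub_add_cancel] at h1
  rw [Real.norm_of_nonneg (hpos _)] at h2
  rw [Real.norm_of_nonneg (hpos _), Real.norm_of_nonneg (Real.exp_pos _).le, neg_neg,
    ← Real.rpow_def_of_pos hr, mul_assoc, ← Real.rpow_add hr]
  have h3 : r ^ n ≤ r ^ (-x₀ - 1 + x) := by
    rw [← Real.rpow_natCast]
    exact Real.rpow_le_rpow_of_exponent_ge hr hr1.le (by linarith)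
  calc u x ≤ r ^ n * u (x - n) := h1
    _ ≤ r ^ (-x₀ - 1 + x) * C := by
      gcongr
      exact hpos _
    _ = _ := mul_comm _ _

/-- The majorant `|(-rX, -r/X; q)_∞|` of one numerator pair. -/
noncomputable def pairMajorant (q r X : ℝ) : ℝ :=
  ‖qPoch q (-((r * X : ℝ) : ℂ))‖ * ‖qPoch q (-((r / X : ℝ) : ℂ))‖

theorem norm_qPoch_neg_ofReal {q : ℝ} (hq0 : 0 < q) (hq1 : q < 1) {s : ℝ} (hs : 0 ≤ s) :
    ‖qPoch q (-(s : ℂ))‖ = (1 + s) * ‖qPoch q (-((s * q : ℝ) : ℂ))‖ := by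
  rw [qPoch_eq_mul hq0 hq1, norm_mul]
  congr 1
  · rw [sub_neg_eq_add, ← Complex.ofReal_one, ← Complex.ofReal_add, Complex.norm_real,
      Real.norm_of_nonneg (by positivity)]
  · push_cast
    ring_nf

theorem pairMajorant_nonneg (q r X : ℝ) : 0 ≤ pairMajorant q r X := by
  unfold pairMajorant
  positivity

theorem pairMajorant_mul {q : ℝ} (hq0 : 0 < q) (hq1 : q < 1) {r X : ℝ} (hr : 0 ≤ r) (hX : 0 < X) :
    pairMajorant q r (X * q) = (q * X + r) / ((1 + r * X) * (q * X)) * pairMajorant q r X := by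
  have h1 := norm_qPoch_neg_ofReal hq0 hq1 (s := r * X) (by positivity)
  have h2 := norm_qPoch_neg_ofReal hq0 hq1 (s := r / (X * q)) (by positivity)
  have e : r / (X * q) * q = r / X := by field_simp
  rw [e] at h2
  have h3 : 0 < 1 + r * X := by positivity
  rw [pairMajorant, pairMajorant, h2, h1, ← mul_assoc r]
  field_simp

theorem pairMajorant_inv (q r X : ℝ) : pairMajorant q r X⁻¹ = pairMajorant q r X := by
  rw [pairMajorant, pairMajorant, mul_comm]
  simp [div_eq_mul_inv]

/-- The product of four pair majorants and `X + 1/X`, over the modulus of the denominator. -/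
noncomputable def integrandMajorant (q : ℝ) (r₁ r₂ r₃ r₄ : ℝ) (f g : ℂ) (X : ℝ) : ℝ :=
  pairMajorant q r₁ X * pairMajorant q r₂ X * pairMajorant q r₃ X * pairMajorant q r₄ X
    * (X + X⁻¹) / ‖qThetaPair q f X * qThetaPair q g X‖

theorem integrandMajorant_nonneg (q : ℝ) (r₁ r₂ r₃ r₄ : ℝ) (f g : ℂ) {X : ℝ} (hX : 0 < X) :
    0 ≤ integrandMajorant q r₁ r₂ r₃ r₄ f g X := by
  have := pairMajorant_nonneg q
  have h1 := this r₁ X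
  have h2 := this r₂ X
  have h3 := this r₃ X
  have h4 := this r₄ X
  unfold integrandMajorant
  positivity

theorem continuous_qThetaPair_rpow {q : ℝ} (hq0 : 0 < q) (hq1 : q < 1) {f : ℂ} (hf : f ≠ 0) :
    Continuous fun x : ℝ => qThetaPair q f ((q ^ x : ℝ) : ℂ) :=
  continuous_iff_continuousAt.mpr fun x =>
    (differentiableAt_qThetaPair_rpow hq0 hq1 hf x).continuousAt

theorem continuous_integrandMajorant {q : ℝ} (hq0 : 0 < q) (hq1 : q < 1) (r₁ r₂ r₃ r₄ : ℝ)
    {f g : ℂ} (hf : f.im ≠ 0) (hg : g.im ≠ 0) :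
    Continuous fun x : ℝ => integrandMajorant q r₁ r₂ r₃ r₄ f g (q ^ x) := by
  have hX (x : ℝ) : 0 < q ^ x := Real.rpow_pos_of_pos hq0 x
  have hc : Continuous fun x : ℝ => q ^ x := Real.continuous_const_rpow hq0.ne'
  have hf0 : f ≠ 0 := by rintro rfl; simp at hf
  have hg0 : g ≠ 0 := by rintro rfl; simp at hg
  have hp (r : ℝ) : Continuous fun x : ℝ => pairMajorant q r (q ^ x) := by
    have hd : Continuous fun x : ℝ => r / q ^ x := continuous_const.div hc fun x => (hX x).ne'
    have h := continuous_qPoch hq0 hq1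
    unfold pairMajorant
    fun_prop
  unfold integrandMajorant
  refine Continuous.div ?_ ?_ fun x => ?_
  · have := hc.inv₀ fun x => (hX x).ne'
    exact ((((hp _).mul (hp _)).mul (hp _)).mul (hp _)).mul (hc.add this)
  · exact ((continuous_qThetaPair_rpow hq0 hq1 hf0).mul
      (continuous_qThetaPair_rpow hq0 hq1 hg0)).norm
  · exact norm_ne_zero_iff.mpr (mul_ne_zero (qThetaPair_ne_zero hq0 hq1 hf (hX x))
      (qThetaPair_ne_zero hq0 hq1 hg (hX x)))

theorem norm_qThetaPair_mul {q : ℝ} (hq0 : 0 < q) (hq1 : q < 1) {f : ℂ} (hf : f ≠ 0) {X : ℝ}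
    (hX : 0 < X) : ‖qThetaPair q f X‖ = q * X ^ 2 * ‖qThetaPair q f ((X * q : ℝ) : ℂ)‖ := by
  have h := congrArg norm (qThetaPair_mul hq0 hq1 hf (X := (X : ℂ)) (by exact_mod_cast hX.ne'))
  rw [norm_neg, norm_mul, norm_mul, norm_pow, Complex.norm_real, Complex.norm_real,
    Real.norm_of_nonneg hq0.le, Real.norm_of_nonneg hX.le] at h
  rw [← h, Complex.ofReal_mul]

theorem integrandMajorant_mul {q : ℝ} (hq0 : 0 < q) (hq1 : q < 1) {r₁ r₂ r₃ r₄ : ℝ}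
    (h₁ : 0 ≤ r₁) (h₂ : 0 ≤ r₂) (h₃ : 0 ≤ r₃) (h₄ : 0 ≤ r₄) {f g : ℂ} (hf : f.im ≠ 0)
    (hg : g.im ≠ 0) {X : ℝ} (hX : 0 < X) :
    integrandMajorant q r₁ r₂ r₃ r₄ f g (X * q)
      = (q * X + r₁) * (q * X + r₂) * (q * X + r₃) * (q * X + r₄) * ((q * X) ^ 2 + 1)
        / ((1 + r₁ * X) * (1 + r₂ * X) * (1 + r₃ * X) * (1 + r₄ * X) * (q ^ 3 * (X ^ 2 + 1)))
        * integrandMajorant q r₁ r₂ r₃ r₄ f g X := by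
  have hf0 : f ≠ 0 := by rintro rfl; simp at hf
  have hg0 : g ≠ 0 := by rintro rfl; simp at hg
  have hXq : 0 < X * q := by positivity
  have n1 : ‖qThetaPair q f ((X * q : ℝ) : ℂ)‖ ≠ 0 :=
    norm_ne_zero_iff.mpr (qThetaPair_ne_zero hq0 hq1 hf hXq)
  have n2 : ‖qThetaPair q g ((X * q : ℝ) : ℂ)‖ ≠ 0 :=
    norm_ne_zero_iff.mpr (qThetaPair_ne_zero hq0 hq1 hg hXq)
  have p1 : 0 < 1 + r₁ * X := by positivity
  have p2 : 0 < 1 + r₂ * X := by positivity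
  have p3 : 0 < 1 + r₃ * X := by positivity
  have p4 : 0 < 1 + r₄ * X := by positivity
  rw [integrandMajorant, integrandMajorant, pairMajorant_mul hq0 hq1 h₁ hX,
    pairMajorant_mul hq0 hq1 h₂ hX, pairMajorant_mul hq0 hq1 h₃ hX,
    pairMajorant_mul hq0 hq1 h₄ hX, norm_mul, norm_mul, norm_qThetaPair_mul hq0 hq1 hf0 hX,
    norm_qThetaPair_mul hq0 hq1 hg0 hX]
  generalize ‖qThetaPair q f ((X * q : ℝ) : ℂ)‖ = u at *
  generalize ‖qThetaPair q g ((X * q : ℝ) : ℂ)‖ = v at *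
  generalize pairMajorant q r₁ X = w₁
  generalize pairMajorant q r₂ X = w₂
  generalize pairMajorant q r₃ X = w₃
  generalize pairMajorant q r₄ X = w₄
  have e1 : X * q + (X * q)⁻¹ = ((q * X) ^ 2 + 1) / (q * X) := by field_simp
  have e2 : X + X⁻¹ = (X ^ 2 + 1) / X := by field_simp
  rw [e1, e2]
  field_simp

/-- As X → 0 the ratio in `integrandMajorant_mul` tends to r₁r₂r₃r₄/q³. This being less than 1 is
exactly what gives exponential decay as x → +∞. -/
theorem integrableOn_integrandMajorant {q : ℝ} (hq0 : 0 < q) (hq1 : q < 1) {r₁ r₂ r₃ r₄ : ℝ}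
    (h₁ : 0 ≤ r₁) (h₂ : 0 ≤ r₂) (h₃ : 0 ≤ r₃) (h₄ : 0 ≤ r₄) (hr : r₁ * r₂ * r₃ * r₄ / q ^ 3 < 1)
    {f g : ℂ} (hf : f.im ≠ 0) (hg : g.im ≠ 0) :
    IntegrableOn (fun x : ℝ => integrandMajorant q r₁ r₂ r₃ r₄ f g (q ^ x)) (Set.Ioi 0) := by
  have hX (x : ℝ) : 0 < q ^ x := Real.rpow_pos_of_pos hq0 x
  obtain ⟨r, hr2, hr1⟩ := exists_between hr
  have hr0 : 0 < r := lt_of_le_of_lt (by positivity) hr2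
  let ρ : ℝ → ℝ := fun X =>
    (q * X + r₁) * (q * X + r₂) * (q * X + r₃) * (q * X + r₄) * ((q * X) ^ 2 + 1)
        / ((1 + r₁ * X) * (1 + r₂ * X) * (1 + r₃ * X) * (1 + r₄ * X) * (q ^ 3 * (X ^ 2 + 1)))
  have hρ : ContinuousAt ρ 0 := by
    refine ContinuousAt.div (by fun_prop) (by fun_prop) ?_
    simp [hq0.ne']
  have hρ0 : ρ 0 < r := by
    have : ρ 0 = r₁ * r₂ * r₃ * r₄ / q ^ 3 := by simp [ρ]
    rwa [this]
  have ht : Tendsto (fun x : ℝ => q ^ x) atTop (𝓝 0) :=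
    tendsto_rpow_atTop_of_base_lt_one q (by linarith) hq1
  have hev : ∀ᶠ x : ℝ in atTop, ρ (q ^ x) < r := (hρ.tendsto.comp ht).eventually_lt_const hρ0
  have hc := continuous_integrandMajorant hq0 hq1 r₁ r₂ r₃ r₄ hf hg
  refine integrable_of_isBigO_exp_neg (neg_pos.mpr (Real.log_neg hr0 hr1)) hc.continuousOn
    (isBigO_exp_of_shift_le hc (fun x => integrandMajorant_nonneg _ _ _ _ _ _ _ (hX x)) hr0 hr1 ?_)
  filter_upwards [hev] with x hx
  rw [Real.rpow_add_one hq0.ne', integrandMajorant_mul hq0 hq1 h₁ h₂ h₃ h₄ hf hg (hX x)]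
  have := integrandMajorant_nonneg q r₁ r₂ r₃ r₄ f g (hX x)
  gcongr

theorem integrandMajorant_inv (q r₁ r₂ r₃ r₄ : ℝ) (f g : ℂ) (X : ℝ) :
    integrandMajorant q r₁ r₂ r₃ r₄ f g X⁻¹ = integrandMajorant q r₁ r₂ r₃ r₄ (-f) (-g) X := by
  simp only [integrandMajorant, pairMajorant_inv, inv_inv, Complex.ofReal_inv, qThetaPair_inv,
    add_comm]

/-- The substitution x ↦ -x replaces X by 1/X, hence (f, g) by (-f, -g), and carries the negative
half-line to the positive one. -/
theorem integrable_integrandMajorant {q : ℝ} (hq0 : 0 < q) (hq1 : q < 1) {r₁ r₂ r₃ r₄ : ℝ}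
    (h₁ : 0 ≤ r₁) (h₂ : 0 ≤ r₂) (h₃ : 0 ≤ r₃) (h₄ : 0 ≤ r₄) (hr : r₁ * r₂ * r₃ * r₄ / q ^ 3 < 1)
    {f g : ℂ} (hf : f.im ≠ 0) (hg : g.im ≠ 0) :
    Integrable fun x : ℝ => integrandMajorant q r₁ r₂ r₃ r₄ f g (q ^ x) := by
  have h1 := integrableOn_integrandMajorant hq0 hq1 h₁ h₂ h₃ h₄ hr hf hg
  have h2 := integrableOn_integrandMajorant hq0 hq1 h₁ h₂ h₃ h₄ hr (f := -f) (g := -g)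
    (by simpa using hf) (by simpa using hg)
  have h3 : IntegrableOn (fun x : ℝ => integrandMajorant q r₁ r₂ r₃ r₄ f g (q ^ x))
      (Set.Iio 0) := by
    have h4 := (Measure.measurePreserving_neg (volume : Measure ℝ)).integrableOn_comp_preimage
      (Homeomorph.neg ℝ).measurableEmbedding (f := fun x : ℝ =>
        integrandMajorant q r₁ r₂ r₃ r₄ f g (q ^ x)) (s := Set.Iio 0)
    refine h4.mp ?_
    have e : (Neg.neg ⁻¹' Set.Iio (0 : ℝ)) = Set.Ioi 0 := by ext; simp
    rw [e]
    refine h2.congr_fun (fun x _ => ?_) measurableSet_Ioi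
    simp only [Function.comp, Real.rpow_neg hq0.le]
    exact (integrandMajorant_inv _ _ _ _ _ _ _ _).symm
  rw [← integrableOn_univ, ← Set.Iio_union_Ici (a := (0 : ℝ))]
  exact h3.union (Iff.mpr integrableOn_Ici_iff_integrableOn_Ioi h1)

/-! ### The integrand as a function of X, and its integrability. -/

/-- The numerator pair `(itX, -it/X; q)_∞`. -/
noncomputable def numeratorPair (q : ℝ) (t X : ℂ) : ℂ :=
  qPoch q (Complex.I * t * X) * qPoch q (-(Complex.I * t * X⁻¹))

/-- The integrand as a function of `X = q^x`. -/
noncomputable def qBetaKernel (q : ℝ) (a b c d f g X : ℂ) : ℂ :=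
  numeratorPair q a X * numeratorPair q b X * numeratorPair q c X * numeratorPair q d X
    * (X + X⁻¹) / (qThetaPair q f X * qThetaPair q g X)

theorem qPochs_eq_qThetaPair {q : ℝ} (hq0 : 0 < q) (f : ℂ) (x : ℝ) :
    qPochs q [f * ((q ^ (-x) : ℝ) : ℂ), q * ((q ^ x : ℝ) : ℂ) / f, -(f * ((q ^ x : ℝ) : ℂ)),
      -(q * ((q ^ (-x) : ℝ) : ℂ) / f)] = qThetaPair q f ((q ^ x : ℝ) : ℂ) := by
  rw [Real.rpow_neg hq0.le, Complex.ofReal_inv]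
  generalize ((q ^ x : ℝ) : ℂ) = X
  have e1 : (q : ℂ) * X / f = q / (f / X) := (div_div_eq_mul_div _ _ _).symm
  have e2 : -((q : ℂ) * X⁻¹ / f) = q / (-(f * X)) := by
    rw [div_neg, div_mul_eq_div_div]
    ring
  rw [e1, e2, ← div_eq_mul_inv]
  simp only [qPochs, List.map_cons, List.map_nil, List.prod_cons, List.prod_nil, qThetaPair, qTheta]
  ring

theorem qBetaIntegrand_eq {q : ℝ} (hq0 : 0 < q) (a b c d f g : ℂ) (x : ℝ) :
    qBetaIntegrand q a b c d f g x = qBetaKernel q a b c d f g ((q ^ x : ℝ) : ℂ) := by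
  have h (l₁ l₂ : List ℂ) : qPochs q (l₁ ++ l₂) = qPochs q l₁ * qPochs q l₂ := by simp [qPochs]
  have h2 := h [f * ((q ^ (-x) : ℝ) : ℂ), q * ((q ^ x : ℝ) : ℂ) / f, -(f * ((q ^ x : ℝ) : ℂ)),
      -(q * ((q ^ (-x) : ℝ) : ℂ) / f)] [g * ((q ^ (-x) : ℝ) : ℂ), q * ((q ^ x : ℝ) : ℂ) / g,
      -(g * ((q ^ x : ℝ) : ℂ)), -(q * ((q ^ (-x) : ℝ) : ℂ) / g)]
  rw [qPochs_eq_qThetaPair hq0, qPochs_eq_qThetaPair hq0] at h2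
  simp only [List.cons_append, List.nil_append] at h2
  rw [qBetaIntegrand, qBetaKernel, h2, Real.rpow_neg hq0.le, Complex.ofReal_inv]
  simp only [qPochs, List.map_cons, List.map_nil, List.prod_cons, List.prod_nil, numeratorPair]
  ring

theorem norm_qPoch_I_mul_le {q : ℝ} (hq0 : 0 < q) (hq1 : q < 1) {t : ℂ} {r : ℝ} (h : ‖t‖ ≤ r)
    {X : ℝ} (hX : 0 < X) :
    ‖qPoch q (Complex.I * t * X)‖ ≤ ‖qPoch q (-((r * X : ℝ) : ℂ))‖ := by
  refine norm_qPoch_le hq0 hq1 ?_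
  rw [norm_mul, norm_mul, Complex.norm_I, one_mul, Complex.norm_real, Real.norm_of_nonneg hX.le]
  gcongr

theorem norm_qPoch_neg_I_mul_le {q : ℝ} (hq0 : 0 < q) (hq1 : q < 1) {t : ℂ} {r : ℝ} (h : ‖t‖ ≤ r)
    {X : ℝ} (hX : 0 < X) :
    ‖qPoch q (-(Complex.I * t * (X : ℂ)⁻¹))‖ ≤ ‖qPoch q (-((r / X : ℝ) : ℂ))‖ := by
  refine norm_qPoch_le hq0 hq1 ?_
  rw [norm_neg, norm_mul, norm_mul, Complex.norm_I, one_mul, norm_inv, Complex.norm_real,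
    Real.norm_of_nonneg hX.le, ← div_eq_mul_inv]
  gcongr

theorem norm_numeratorPair_le {q : ℝ} (hq0 : 0 < q) (hq1 : q < 1) {t : ℂ} {r : ℝ} (h : ‖t‖ ≤ r)
    {X : ℝ} (hX : 0 < X) : ‖numeratorPair q t X‖ ≤ pairMajorant q r X := by
  rw [numeratorPair, norm_mul]
  exact mul_le_mul (norm_qPoch_I_mul_le hq0 hq1 h hX) (norm_qPoch_neg_I_mul_le hq0 hq1 h hX)
    (norm_nonneg _) (norm_nonneg _)

theorem norm_ofReal_add_inv {X : ℝ} (hX : 0 < X) : ‖(X : ℂ) + (X : ℂ)⁻¹‖ = X + X⁻¹ := by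
  rw [← Complex.ofReal_inv, ← Complex.ofReal_add, Complex.norm_real,
    Real.norm_of_nonneg (by positivity)]

theorem norm_qBetaKernel_le {q : ℝ} (hq0 : 0 < q) (hq1 : q < 1) {a b c d : ℂ} {r₁ r₂ r₃ r₄ : ℝ}
    (h₁ : ‖a‖ ≤ r₁) (h₂ : ‖b‖ ≤ r₂) (h₃ : ‖c‖ ≤ r₃) (h₄ : ‖d‖ ≤ r₄) (f g : ℂ) {X : ℝ}
    (hX : 0 < X) :
    ‖qBetaKernel q a b c d f g X‖ ≤ integrandMajorant q r₁ r₂ r₃ r₄ f g X := by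
  have p1 := norm_numeratorPair_le hq0 hq1 h₁ hX
  have p2 := norm_numeratorPair_le hq0 hq1 h₂ hX
  have p3 := norm_numeratorPair_le hq0 hq1 h₃ hX
  have p4 := norm_numeratorPair_le hq0 hq1 h₄ hX
  have m := pairMajorant_nonneg q
  have m1 := m r₁ X
  have m2 := m r₂ X
  have m3 := m r₃ X
  rw [qBetaKernel, integrandMajorant, norm_div, norm_mul, norm_mul, norm_mul, norm_mul,
    norm_ofReal_add_inv hX]
  gcongr

theorem continuous_numeratorPair {q : ℝ} (hq0 : 0 < q) (hq1 : q < 1) (t : ℂ) :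
    Continuous fun x : ℝ => numeratorPair q t ((q ^ x : ℝ) : ℂ) := by
  have hc : Continuous fun x : ℝ => ((q ^ x : ℝ) : ℂ) :=
    Complex.continuous_ofReal.comp (Real.continuous_const_rpow hq0.ne')
  have hi := hc.inv₀ fun x => by exact_mod_cast (Real.rpow_pos_of_pos hq0 x).ne'
  have h := continuous_qPoch hq0 hq1
  exact (h.comp (continuous_const.mul hc)).mul (h.comp (continuous_const.mul hi).neg)

theorem continuous_div_qThetaPair {q : ℝ} (hq0 : 0 < q) (hq1 : q < 1) {f g : ℂ} (hf : f.im ≠ 0)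
    (hg : g.im ≠ 0) {u : ℝ → ℂ} (hu : Continuous u) :
    Continuous fun x : ℝ =>
      u x / (qThetaPair q f ((q ^ x : ℝ) : ℂ) * qThetaPair q g ((q ^ x : ℝ) : ℂ)) := by
  have hX (x : ℝ) : 0 < q ^ x := Real.rpow_pos_of_pos hq0 x
  have hf0 : f ≠ 0 := by rintro rfl; simp at hf
  have hg0 : g ≠ 0 := by rintro rfl; simp at hg
  exact hu.div ((continuous_qThetaPair_rpow hq0 hq1 hf0).mul
    (continuous_qThetaPair_rpow hq0 hq1 hg0)) fun x =>
      mul_ne_zero (qThetaPair_ne_zero hq0 hq1 hf (hX x)) (qThetaPair_ne_zero hq0 hq1 hg (hX x))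

theorem continuous_qBetaKernel {q : ℝ} (hq0 : 0 < q) (hq1 : q < 1) (a b c d : ℂ) {f g : ℂ}
    (hf : f.im ≠ 0) (hg : g.im ≠ 0) :
    Continuous fun x : ℝ => qBetaKernel q a b c d f g ((q ^ x : ℝ) : ℂ) := by
  have hp := continuous_numeratorPair hq0 hq1
  have hc : Continuous fun x : ℝ => ((q ^ x : ℝ) : ℂ) :=
    Complex.continuous_ofReal.comp (Real.continuous_const_rpow hq0.ne')
  have hi := hc.inv₀ fun x => by exact_mod_cast (Real.rpow_pos_of_pos hq0 x).ne'
  exact continuous_div_qThetaPair hq0 hq1 hf hg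
    (((((hp a).mul (hp b)).mul (hp c)).mul (hp d)).mul (hc.add hi))

theorem norm_parameters_lt_one {q : ℝ} (hq0 : 0 < q) {a b c d : ℂ}
    (h : ‖a * b * c * d / (q : ℂ) ^ 3‖ < 1) : ‖a‖ * ‖b‖ * ‖c‖ * ‖d‖ / q ^ 3 < 1 := by
  rwa [norm_div, norm_mul, norm_mul, norm_mul, norm_pow, Complex.norm_real,
    Real.norm_of_nonneg hq0.le] at h

theorem integrable_qBetaKernel {q : ℝ} (hq0 : 0 < q) (hq1 : q < 1) {a b c d f g : ℂ}
    (h : ‖a * b * c * d / (q : ℂ) ^ 3‖ < 1) (hf : f.im ≠ 0) (hg : g.im ≠ 0) :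
    Integrable fun x : ℝ => qBetaKernel q a b c d f g ((q ^ x : ℝ) : ℂ) :=
  (integrable_integrandMajorant hq0 hq1 (norm_nonneg a) (norm_nonneg b) (norm_nonneg c)
    (norm_nonneg d) (norm_parameters_lt_one hq0 h) hf hg).mono'
    (continuous_qBetaKernel hq0 hq1 a b c d hf hg).aestronglyMeasurable
    (Eventually.of_forall fun x => norm_qBetaKernel_le hq0 hq1 le_rfl le_rfl le_rfl le_rfl f g
      (Real.rpow_pos_of_pos hq0 x))

/-! ### The contiguous relation a ↦ aq. -/

/-- The function whose `q`-difference gives the contiguous relation for the integral. -/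
noncomputable def contiguityPrimitive (q : ℝ) (a b c d f g X : ℂ) : ℂ :=
  X⁻¹ ^ 2 * (qPoch q (Complex.I * a * X) * qPoch q (-(Complex.I * (a * q) * X⁻¹)))
    * (qPoch q (Complex.I * b * X) * qPoch q (-(Complex.I * (b * q) * X⁻¹)))
    * (qPoch q (Complex.I * c * X) * qPoch q (-(Complex.I * (c * q) * X⁻¹)))
    * (qPoch q (Complex.I * d * X) * qPoch q (-(Complex.I * (d * q) * X⁻¹)))
    / (qThetaPair q f X * qThetaPair q g X)

/-- Shifting X to Xq moves one linear factor between the two products of each numerator pair, and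
quasi-periodicity turns X⁻² into X². After cancellation of the common infinite products, a rational
identity in X remains. -/
theorem contiguityPrimitive_sub {q : ℝ} (hq0 : 0 < q) (hq1 : q < 1) (a b c d : ℂ) {f g : ℂ}
    (hf : f.im ≠ 0) (hg : g.im ≠ 0) {X : ℝ} (hX : 0 < X) :
    Complex.I * a * (contiguityPrimitive q a b c d f g X
        - contiguityPrimitive q a b c d f g ((X * q : ℝ) : ℂ))
      = (1 - a * b * c * d) * qBetaKernel q a (b * q) (c * q) (d * q) f g X
        - (1 - a * b) * (1 - a * c) * (1 - a * d)
          * qBetaKernel q (a * q) (b * q) (c * q) (d * q) f g X := by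
  have hf0 : f ≠ 0 := by rintro rfl; simp at hf
  have hg0 : g ≠ 0 := by rintro rfl; simp at hg
  have hq : (q : ℂ) ≠ 0 := by exact_mod_cast hq0.ne'
  have hXc : (X : ℂ) ≠ 0 := by exact_mod_cast hX.ne'
  have hXq : 0 < X * q := by positivity
  have n1 := qThetaPair_ne_zero hq0 hq1 hf hXq
  have n2 := qThetaPair_ne_zero hq0 hq1 hg hXq
  have e1 := qThetaPair_mul hq0 hq1 hf0 hXc
  have e2 := qThetaPair_mul hq0 hq1 hg0 hXc
  rw [Complex.ofReal_mul] at n1 n2 ⊢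
  have u1 (t : ℂ) : qPoch q (Complex.I * t * X)
      = (1 - Complex.I * X * t) * qPoch q (Complex.I * (t * q) * X) := by
    rw [qPoch_eq_mul hq0 hq1]
    ring_nf
  have u2 (t : ℂ) : qPoch q (Complex.I * t * (X * q)) = qPoch q (Complex.I * (t * q) * X) := by
    ring_nf
  have hI : Complex.I * (X : ℂ)⁻¹ = -(Complex.I * X)⁻¹ := by
    rw [mul_inv, Complex.inv_I]
    ring
  have v1 (t : ℂ) : qPoch q (-(Complex.I * t * (X : ℂ)⁻¹))
      = (1 - (Complex.I * X)⁻¹ * t) * qPoch q (-(Complex.I * (t * q) * (X : ℂ)⁻¹)) := by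
    rw [qPoch_eq_mul hq0 hq1]
    congr 1
    · linear_combination t * hI
    · ring_nf
  have v2 (t : ℂ) : qPoch q (-(Complex.I * (t * q) * ((X : ℂ) * q)⁻¹))
      = (1 - (Complex.I * X)⁻¹ * t) * qPoch q (-(Complex.I * (t * q) * (X : ℂ)⁻¹)) := by
    rw [← v1, mul_inv]
    congr 2
    field_simp
  have w1 : qThetaPair q f X = -(q * X ^ 2 * qThetaPair q f (X * q)) := by rw [e1]; ring
  have w2 : qThetaPair q g X = -(q * X ^ 2 * qThetaPair q g (X * q)) := by rw [e2]; ring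
  simp only [contiguityPrimitive, qBetaKernel, numeratorPair, u2, v2]
  rw [u1 a, u1 b, u1 c, u1 d, v1 a, w1, w2]
  generalize qThetaPair q f (X * q) = F at *
  generalize qThetaPair q g (X * q) = G at *
  generalize qPoch q (Complex.I * (a * q) * X) = A
  generalize qPoch q (Complex.I * (b * q) * X) = B
  generalize qPoch q (Complex.I * (c * q) * X) = C
  generalize qPoch q (Complex.I * (d * q) * X) = D
  generalize qPoch q (-(Complex.I * (a * q) * (X : ℂ)⁻¹)) = A'
  generalize qPoch q (-(Complex.I * (b * q) * (X : ℂ)⁻¹)) = B'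
  generalize qPoch q (-(Complex.I * (c * q) * (X : ℂ)⁻¹)) = C'
  generalize qPoch q (-(Complex.I * (d * q) * (X : ℂ)⁻¹)) = D'
  have hs : Complex.I * (X : ℂ) ≠ 0 := mul_ne_zero Complex.I_ne_zero hXc
  have hXs : (X : ℂ) = -Complex.I * (Complex.I * X) := by
    linear_combination (X : ℂ) * Complex.I_sq
  -- With s = iX the linear factors become 1 - ts and 1 - t/s, and both sides are antisymmetric
  -- under s ↦ 1/s.
  generalize hsd : Complex.I * (X : ℂ) = s at *
  have k1 : (X : ℂ) + (X : ℂ)⁻¹ = -Complex.I * (s - s⁻¹) := by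
    rw [hXs, mul_inv, inv_neg, Complex.inv_I]
    ring
  have k2 : (X : ℂ) ^ 2 = -s ^ 2 := by
    rw [hXs]
    linear_combination s ^ 2 * Complex.I_sq
  have k3 : (X : ℂ)⁻¹ ^ 2 = -s⁻¹ ^ 2 := by
    rw [inv_pow, k2, inv_neg, inv_pow]
  have k4 : ((X : ℂ) * q)⁻¹ ^ 2 = -s⁻¹ ^ 2 * (q : ℂ)⁻¹ ^ 2 := by
    rw [mul_inv, mul_pow, k3]
  rw [k1, k3, k4, k2]
  field_simp
  ring

/-- The chosen majorant parameters have product |abcd| q³, so the decay condition reads |abcd| < 1.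
The leftover factor is (1+βX)(1+γX)(1+δX)/(X(X+α)), with α, β, γ, δ the moduli of the parameters. It
is compared with X + 1/X monomial by monomial in the numerator, and each bracket of the constant
treats one degree. -/
theorem norm_contiguityPrimitive_le {q : ℝ} (hq0 : 0 < q) (hq1 : q < 1) {a : ℂ} (ha : a ≠ 0)
    (b c d f g : ℂ) {X : ℝ} (hX : 0 < X) :
    ‖contiguityPrimitive q a b c d f g X‖
      ≤ (1 / ‖a‖ + (‖b‖ + ‖c‖ + ‖d‖) + (‖b‖ * ‖c‖ + ‖b‖ * ‖d‖ + ‖c‖ * ‖d‖) / ‖a‖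
          + ‖b‖ * ‖c‖ * ‖d‖)
        * integrandMajorant q ‖a‖ (‖b‖ * q) (‖c‖ * q) (‖d‖ * q) f g X := by
  have hα : 0 < ‖a‖ := norm_pos_iff.mpr ha
  have hnq (t : ℂ) : ‖t * q‖ ≤ ‖t‖ * q := by
    rw [norm_mul, Complex.norm_real, Real.norm_of_nonneg hq0.le]
  have ht (t : ℂ) : ‖qPoch q (Complex.I * t * X) * qPoch q (-(Complex.I * (t * q) * (X : ℂ)⁻¹))‖
      ≤ (1 + ‖t‖ * X) * pairMajorant q (‖t‖ * q) X := by
    have h1 := norm_qPoch_I_mul_le hq0 hq1 (le_refl ‖t‖) hX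
    have h2 := norm_qPoch_neg_I_mul_le hq0 hq1 (hnq t) hX
    rw [norm_qPoch_neg_ofReal hq0 hq1 (by positivity), mul_right_comm ‖t‖] at h1
    rw [norm_mul, pairMajorant]
    exact (mul_le_mul h1 h2 (norm_nonneg _) (by positivity)).trans_eq (mul_assoc _ _ _)
  have hta : ‖qPoch q (Complex.I * a * X) * qPoch q (-(Complex.I * (a * q) * (X : ℂ)⁻¹))‖
      ≤ (1 + ‖a‖ / X)⁻¹ * pairMajorant q ‖a‖ X := by
    have h1 := norm_qPoch_I_mul_le hq0 hq1 (le_refl ‖a‖) hX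
    have h2 := norm_qPoch_neg_I_mul_le hq0 hq1 (hnq a) hX
    have h3 := norm_qPoch_neg_ofReal hq0 hq1 (s := ‖a‖ / X) (by positivity)
    rw [div_mul_eq_mul_div] at h3
    have h4 : 0 < 1 + ‖a‖ / X := by positivity
    rw [norm_mul, pairMajorant, h3]
    calc _ ≤ _ := mul_le_mul h1 h2 (norm_nonneg _) (norm_nonneg _)
      _ = _ := by field_simp
  have hC : X⁻¹ ^ 2 * (1 + ‖a‖ / X)⁻¹ * (1 + ‖b‖ * X) * (1 + ‖c‖ * X) * (1 + ‖d‖ * X)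
      ≤ (1 / ‖a‖ + (‖b‖ + ‖c‖ + ‖d‖) + (‖b‖ * ‖c‖ + ‖b‖ * ‖d‖ + ‖c‖ * ‖d‖) / ‖a‖
          + ‖b‖ * ‖c‖ * ‖d‖) * (X + X⁻¹) := by
    have hβ := norm_nonneg b
    have hγ := norm_nonneg c
    have hδ := norm_nonneg d
    generalize ‖a‖ = α at *
    generalize ‖b‖ = β at *
    generalize ‖c‖ = γ at *
    generalize ‖d‖ = δ at *
    have e1 : X⁻¹ ^ 2 * (1 + α / X)⁻¹ * (1 + β * X) * (1 + γ * X) * (1 + δ * X)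
      = (1 + β * X) * (1 + γ * X) * (1 + δ * X) / (X * (X + α)) := by
      field_simp
    have e2 : X + X⁻¹ = (X ^ 2 + 1) / X := by field_simp
    rw [e1, e2, ← mul_div_assoc, div_le_div_iff₀ (by positivity) hX]
    have e3 : (1 / α + (β + γ + δ) + (β * γ + β * δ + γ * δ) / α + β * γ * δ)
        * (X ^ 2 + 1) * (X * (X + α))
        = (1 + β * X) * (1 + γ * X) * (1 + δ * X) * X
          + X * ((1 / α) * (X ^ 3 + α * X ^ 2 + X)
            + (β + γ + δ) * (X ^ 3 + α * X ^ 2 + α)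
            + (β * γ + β * δ + γ * δ) / α * (X ^ 3 + X + α)
            + β * γ * δ * (α * X ^ 2 + X + α)) := by
      field_simp
      ring
    rw [e3]
    have : 0 ≤ X * ((1 / α) * (X ^ 3 + α * X ^ 2 + X)
            + (β + γ + δ) * (X ^ 3 + α * X ^ 2 + α)
            + (β * γ + β * δ + γ * δ) / α * (X ^ 3 + X + α)
            + β * γ * δ * (α * X ^ 2 + X + α)) := by positivity
    linarith
  have m := pairMajorant_nonneg q
  have m1 := m ‖a‖ X
  have m2 := m (‖b‖ * q) X
  have m3 := m (‖c‖ * q) X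
  have m4 := m (‖d‖ * q) X
  have hX2 : ‖(X : ℂ)⁻¹ ^ 2‖ = X⁻¹ ^ 2 := by
    rw [norm_pow, norm_inv, Complex.norm_real, Real.norm_of_nonneg hX.le]
  rw [contiguityPrimitive, norm_div, norm_mul, norm_mul, norm_mul, norm_mul, hX2,
    integrandMajorant, ← mul_div_assoc]
  refine div_le_div_of_nonneg_right ?_ (norm_nonneg _)
  calc _ ≤ X⁻¹ ^ 2 * ((1 + ‖a‖ / X)⁻¹ * pairMajorant q ‖a‖ X)
        * ((1 + ‖b‖ * X) * pairMajorant q (‖b‖ * q) X)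
        * ((1 + ‖c‖ * X) * pairMajorant q (‖c‖ * q) X)
        * ((1 + ‖d‖ * X) * pairMajorant q (‖d‖ * q) X) := by
        gcongr
        exacts [ht b, ht c, ht d]
    _ = X⁻¹ ^ 2 * (1 + ‖a‖ / X)⁻¹ * (1 + ‖b‖ * X) * (1 + ‖c‖ * X) * (1 + ‖d‖ * X)
        * (pairMajorant q ‖a‖ X * pairMajorant q (‖b‖ * q) X * pairMajorant q (‖c‖ * q) X
          * pairMajorant q (‖d‖ * q) X) := by ring
    _ ≤ _ := mul_le_mul_of_nonneg_right hC (by positivity)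
    _ = _ := by ring

theorem integrable_contiguityPrimitive {q : ℝ} (hq0 : 0 < q) (hq1 : q < 1) {a b c d f g : ℂ}
    (ha : a ≠ 0) (h : ‖a * b * c * d‖ < 1) (hf : f.im ≠ 0) (hg : g.im ≠ 0) :
    Integrable fun x : ℝ => contiguityPrimitive q a b c d f g ((q ^ x : ℝ) : ℂ) := by
  have hr : ‖a‖ * (‖b‖ * q) * (‖c‖ * q) * (‖d‖ * q) / q ^ 3 < 1 := by
    rw [norm_mul, norm_mul, norm_mul] at h
    convert h using 1
    field_simp
  have hc : Continuous fun x : ℝ => ((q ^ x : ℝ) : ℂ) :=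
    Complex.continuous_ofReal.comp (Real.continuous_const_rpow hq0.ne')
  have hi := hc.inv₀ fun x => by exact_mod_cast (Real.rpow_pos_of_pos hq0 x).ne'
  have hp := continuous_qPoch hq0 hq1
  have h2 : Continuous fun p : ℂ × ℂ =>
      p.2 ^ 2 * (qPoch q (Complex.I * a * p.1) * qPoch q (-(Complex.I * (a * q) * p.2)))
      * (qPoch q (Complex.I * b * p.1) * qPoch q (-(Complex.I * (b * q) * p.2)))
      * (qPoch q (Complex.I * c * p.1) * qPoch q (-(Complex.I * (c * q) * p.2)))
      * (qPoch q (Complex.I * d * p.1) * qPoch q (-(Complex.I * (d * q) * p.2))) := by fun_prop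
  refine ((integrable_integrandMajorant hq0 hq1 (norm_nonneg a) (by positivity) (by positivity)
    (by positivity) hr hf hg).const_mul _).mono'
    (continuous_div_qThetaPair hq0 hq1 hf hg (h2.comp (hc.prodMk hi))).aestronglyMeasurable
    (Eventually.of_forall fun x => norm_contiguityPrimitive_le hq0 hq1 ha b c d f g
      (Real.rpow_pos_of_pos hq0 x))

/-- The integral of `qBetaKernel` over the real line. -/
noncomputable def qBetaIntegral (q : ℝ) (a b c d f g : ℂ) : ℂ :=
  ∫ x : ℝ, qBetaKernel q a b c d f g ((q ^ x : ℝ) : ℂ)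

/-- The primitive is taken at a, b/q, c/q, d/q, whose product is abcd/q³. It is integrable, so its
unit translate has the same integral. -/
theorem qBetaIntegral_contiguous {q : ℝ} (hq0 : 0 < q) (hq1 : q < 1) {a b c d f g : ℂ}
    (h : ‖a * b * c * d / (q : ℂ) ^ 3‖ < 1) (hf : f.im ≠ 0) (hg : g.im ≠ 0) :
    (1 - a * b * c * d / (q : ℂ) ^ 3) * qBetaIntegral q a b c d f g
      = (1 - a * b / q) * (1 - a * c / q) * (1 - a * d / q)
        * qBetaIntegral q (a * q) b c d f g := by
  have hq : (q : ℂ) ≠ 0 := by exact_mod_cast hq0.ne'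
  -- The bound on the primitive divides by |a|; for a = 0 both sides are the same integral.
  rcases eq_or_ne a 0 with rfl | ha
  · simp
  have e : a * (b / q) * (c / q) * (d / q) = a * b * c * d / (q : ℂ) ^ 3 := by field_simp
  have h2 : ‖a * q * b * c * d / (q : ℂ) ^ 3‖ < 1 := by
    rw [show a * q * b * c * d / (q : ℂ) ^ 3 = a * b * c * d / (q : ℂ) ^ 3 * q by ring, norm_mul,
      Complex.norm_real, Real.norm_of_nonneg hq0.le]
    nlinarith [norm_nonneg (a * b * c * d / (q : ℂ) ^ 3)]
  have hG := integrable_contiguityPrimitive hq0 hq1 (b := b / q) (c := c / q) (d := d / q) ha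
    (by rwa [e]) hf hg
  have hF1 := integrable_qBetaKernel hq0 hq1 h hf hg
  have hF2 := integrable_qBetaKernel hq0 hq1 h2 hf hg
  have hd (x : ℝ) := contiguityPrimitive_sub hq0 hq1 a (b / q) (c / q) (d / q) hf hg
    (Real.rpow_pos_of_pos hq0 x)
  simp only [← Real.rpow_add_one hq0.ne', div_mul_cancel₀ _ hq, e] at hd
  have h3 : ∫ x : ℝ, Complex.I * a
      * (contiguityPrimitive q a (b / q) (c / q) (d / q) f g ((q ^ x : ℝ) : ℂ)
        - contiguityPrimitive q a (b / q) (c / q) (d / q) f g ((q ^ (x + 1) : ℝ) : ℂ)) = 0 := by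
    rw [integral_const_mul, integral_sub hG (hG.comp_add_right 1),
      integral_add_right_eq_self (fun x : ℝ =>
        contiguityPrimitive q a (b / q) (c / q) (d / q) f g ((q ^ x : ℝ) : ℂ)), sub_self, mul_zero]
  simp_rw [hd] at h3
  rw [integral_sub (hF1.const_mul _) (hF2.const_mul _), integral_const_mul, integral_const_mul,
    sub_eq_zero] at h3
  simp only [mul_div_assoc] at h3 ⊢
  exact h3

/-! ### Eliminating the four parameters. -/

/-- Since |a q^N| ≤ |a|, the majorant built for a serves every N. -/
theorem tendsto_qBetaIntegral {q : ℝ} (hq0 : 0 < q) (hq1 : q < 1) {a b c d f g : ℂ}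
    (h : ‖a * b * c * d / (q : ℂ) ^ 3‖ < 1) (hf : f.im ≠ 0) (hg : g.im ≠ 0) :
    Tendsto (fun N : ℕ => qBetaIntegral q (a * q ^ N) b c d f g) atTop
      (𝓝 (qBetaIntegral q 0 b c d f g)) := by
  have hn : ‖(q : ℂ)‖ < 1 := by
    rwa [Complex.norm_real, Real.norm_eq_abs, abs_of_pos hq0]
  have ht : Tendsto (fun N : ℕ => a * (q : ℂ) ^ N) atTop (𝓝 0) := by
    simpa using (tendsto_pow_atTop_nhds_zero_of_norm_lt_one hn).const_mul a
  refine tendsto_integral_of_dominated_convergence _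
    (fun N => (continuous_qBetaKernel hq0 hq1 _ b c d hf hg).aestronglyMeasurable)
    (integrable_integrandMajorant hq0 hq1 (norm_nonneg a) (norm_nonneg b) (norm_nonneg c)
      (norm_nonneg d) (norm_parameters_lt_one hq0 h) hf hg)
    (fun N => Eventually.of_forall fun x => norm_qBetaKernel_le hq0 hq1 ?_ le_rfl le_rfl le_rfl f g
      (Real.rpow_pos_of_pos hq0 x))
    (Eventually.of_forall fun x => ?_)
  · rw [norm_mul, norm_pow]
    exact mul_le_of_le_one_right (norm_nonneg _) (pow_le_one₀ (norm_nonneg _) hn.le)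
  · have hc : Continuous fun t : ℂ => qBetaKernel q t b c d f g ((q ^ x : ℝ) : ℂ) := by
      have := continuous_qPoch hq0 hq1
      unfold qBetaKernel numeratorPair
      fun_prop
    exact (hc.tendsto 0).comp ht

theorem qBetaIntegral_eq_zero_left {q : ℝ} (hq0 : 0 < q) (hq1 : q < 1) {a b c d f g : ℂ}
    (h : ‖a * b * c * d / (q : ℂ) ^ 3‖ < 1) (hf : f.im ≠ 0) (hg : g.im ≠ 0) :
    qPoch q (a * b * c * d / (q : ℂ) ^ 3) * qBetaIntegral q a b c d f g
      = qPoch q (a * b / q) * qPoch q (a * c / q) * qPoch q (a * d / q)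
        * qBetaIntegral q 0 b c d f g := by
  have hn : ‖(q : ℂ)‖ < 1 := by
    rwa [Complex.norm_real, Real.norm_eq_abs, abs_of_pos hq0]
  have hN (N : ℕ) : (∏ n ∈ Finset.range N, (1 - a * b * c * d / (q : ℂ) ^ 3 * (q : ℂ) ^ n))
        * qBetaIntegral q a b c d f g
      = (∏ n ∈ Finset.range N, (1 - a * b / q * (q : ℂ) ^ n))
        * (∏ n ∈ Finset.range N, (1 - a * c / q * (q : ℂ) ^ n))
        * (∏ n ∈ Finset.range N, (1 - a * d / q * (q : ℂ) ^ n))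
        * qBetaIntegral q (a * q ^ N) b c d f g := by
    induction N with
    | zero => simp
    | succ N ih =>
      have e : a * q ^ N * b * c * d / (q : ℂ) ^ 3 = a * b * c * d / (q : ℂ) ^ 3 * (q : ℂ) ^ N := by
        ring
      have h2 : ‖a * q ^ N * b * c * d / (q : ℂ) ^ 3‖ < 1 := by
        rw [e, norm_mul, norm_pow]
        exact (mul_le_of_le_one_right (norm_nonneg _) (pow_le_one₀ (norm_nonneg _) hn.le)).trans_lt h
      have h3 := qBetaIntegral_contiguous hq0 hq1 h2 hf hg
      rw [e, mul_assoc a ((q : ℂ) ^ N) q, ← pow_succ] at h3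
      rw [Finset.prod_range_succ, mul_right_comm, ih, Finset.prod_range_succ,
        Finset.prod_range_succ, Finset.prod_range_succ]
      linear_combination (∏ n ∈ Finset.range N, (1 - a * b / q * (q : ℂ) ^ n))
        * (∏ n ∈ Finset.range N, (1 - a * c / q * (q : ℂ) ^ n))
        * (∏ n ∈ Finset.range N, (1 - a * d / q * (q : ℂ) ^ n)) * h3
  have hp := tendsto_prod_qPoch hq0 hq1
  refine tendsto_nhds_unique ((hp _).mul_const _) (Tendsto.congr (fun N => (hN N).symm) ?_)
  exact (((hp _).mul (hp _)).mul (hp _)).mul (tendsto_qBetaIntegral hq0 hq1 h hf hg)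

/-- Reduction of the four-parameter integral to the parameter-free one. -/
theorem qBetaIntegral_eq {q : ℝ} (hq0 : 0 < q) (hq1 : q < 1) {a b c d f g : ℂ}
    (h : ‖a * b * c * d / (q : ℂ) ^ 3‖ < 1) (hf : f.im ≠ 0) (hg : g.im ≠ 0) :
    qPoch q (a * b * c * d / (q : ℂ) ^ 3) * qBetaIntegral q a b c d f g
      = qPoch q (a * b / q) * qPoch q (a * c / q) * qPoch q (a * d / q) * qPoch q (b * c / q)
        * qPoch q (b * d / q) * qPoch q (c * d / q) * qBetaIntegral q 0 0 0 0 f g := by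
  have s2 (u v w t : ℂ) : qBetaIntegral q u v w t f g = qBetaIntegral q v u w t f g := by
    simp only [qBetaIntegral, qBetaKernel, mul_comm (numeratorPair q u _)]
  have s3 (u v w t : ℂ) : qBetaIntegral q u v w t f g = qBetaIntegral q w u v t f g := by
    simp only [qBetaIntegral, qBetaKernel]
    congr 1
    funext x
    ring
  have s4 (u v w t : ℂ) : qBetaIntegral q u v w t f g = qBetaIntegral q t u v w f g := by
    simp only [qBetaIntegral, qBetaKernel]
    congr 1
    funext x
    ring
  have h1 := qBetaIntegral_eq_zero_left hq0 hq1 h hf hg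
  -- Once one parameter is 0 the convergence condition is automatic and the factor (abcd/q³; q)_∞ is
  -- 1.
  have h2 := qBetaIntegral_eq_zero_left hq0 hq1 (a := b) (b := 0) (c := c) (d := d) (by simp) hf hg
  have h3 := qBetaIntegral_eq_zero_left hq0 hq1 (a := c) (b := 0) (c := 0) (d := d) (by simp) hf hg
  have h4 := qBetaIntegral_eq_zero_left hq0 hq1 (a := d) (b := 0) (c := 0) (d := 0) (by simp) hf hg
  simp only [mul_zero, zero_mul, zero_div, qPoch_zero, one_mul] at h2 h3 h4
  rw [h1, s2 0 b, h2, s3 0 0 c, h3, s4 0 0 0 d, h4]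
  ring

/-! ### Folding the parameter-free integral onto one period. -/

theorem integral_eq_intervalIntegral_tsum {F : ℝ → ℂ} (hF : Integrable F) :
    ∫ x, F x = ∫ x in (0 : ℝ)..1, ∑' n : ℤ, F (x + n) := by
  have h1 := hF.hasSum_intervalIntegral_comp_add_int
  have h2 := hF.norm.hasSum_intervalIntegral_comp_add_int.summable
  simp only [intervalIntegral.integral_of_le zero_le_one] at h1 h2 ⊢
  exact h1.unique (hasSum_integral_of_summable_integral_norm
    (fun n => (hF.comp_add_right (n : ℝ)).integrableOn) h2)

theorem qThetaPair_mul_zpow {q : ℝ} (hq0 : 0 < q) (hq1 : q < 1) {f X : ℂ} (hf : f ≠ 0)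
    (hX : X ≠ 0) (n : ℤ) :
    (q : ℂ) ^ (n ^ 2) * X ^ (2 * n) * qThetaPair q f (X * q ^ n) = (-1) ^ n * qThetaPair q f X := by
  have hq : (q : ℂ) ≠ 0 := by exact_mod_cast hq0.ne'
  have hm1 : (-1 : ℂ) ≠ 0 := by norm_num
  have step (m : ℤ) :
      (q : ℂ) ^ ((m + 1) ^ 2) * X ^ (2 * (m + 1)) * qThetaPair q f (X * q ^ (m + 1))
        = -((q : ℂ) ^ (m ^ 2) * X ^ (2 * m) * qThetaPair q f (X * q ^ m)) := by
    have h := qThetaPair_mul hq0 hq1 hf (X := X * q ^ m) (mul_ne_zero hX (zpow_ne_zero _ hq))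
    rw [mul_assoc X, ← zpow_add_one₀ hq] at h
    have e1 : (q : ℂ) ^ ((m + 1) ^ 2) = q ^ (m ^ 2) * (q ^ m) ^ 2 * q := by
      rw [← zpow_natCast ((q : ℂ) ^ m), ← zpow_mul, ← zpow_add₀ hq, ← zpow_add_one₀ hq]
      congr 1
      push_cast
      ring
    have e2 : X ^ (2 * (m + 1)) = X ^ (2 * m) * X ^ 2 := by
      rw [mul_add, zpow_add₀ hX]
      rfl
    rw [e1, e2]
    linear_combination (q : ℂ) ^ (m ^ 2) * X ^ (2 * m) * h
  induction n with
  | zero => simp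
  | succ n ih => rw [step, ih, zpow_add_one₀ hm1]; ring
  | pred n ih =>
    have h := step (-(n : ℤ) - 1)
    rw [sub_add_cancel, ih] at h
    rw [zpow_sub_one₀ hm1]
    simp only [inv_neg, inv_one]
    linear_combination h

/-- The value `(q; q)_∞ (-X², -q/X²; q)_∞ / X` of `∑ q^(2n²) X^(4n) (qⁿX + 1/(qⁿX))`. -/
noncomputable def thetaDenominatorSum (q : ℝ) (X : ℂ) : ℂ := qPoch q q * qTheta q (-X ^ 2) / X

/-- In the product of two pairings the signs (-1)ⁿ cancel, so the n-th translate carries q^(2n²)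
X^(4n) (qⁿX + 1/(qⁿX)). Its two summands are the terms of index 2n+1 and 2n of the theta series at
-X², divided by X. -/
theorem tsum_qBetaKernel_zero {q : ℝ} (hq0 : 0 < q) (hq1 : q < 1) {f g X : ℂ} (hf : f ≠ 0)
    (hg : g ≠ 0) (hX : X ≠ 0) :
    ∑' n : ℤ, qBetaKernel q 0 0 0 0 f g (X * q ^ n)
      = thetaDenominatorSum q X / (qThetaPair q f X * qThetaPair q g X) := by
  have hq : (q : ℂ) ≠ 0 := by exact_mod_cast hq0.ne'
  have hz : -X ^ 2 ≠ 0 := neg_ne_zero.mpr (pow_ne_zero 2 hX)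
  have hs := hasSum_thetaTerm hq0 hq1 hz
  have i1 : Function.Injective fun n : ℤ => 2 * n := fun a b h => by simpa using h
  have i2 : Function.Injective fun n : ℤ => 2 * n + 1 := fun a b h => by simpa using h
  have hsum := tsum_int_even_add_odd hs.summable
  have hadd := Summable.tsum_add (hs.summable.comp_injective i1) (hs.summable.comp_injective i2)
  simp only [Function.comp] at hadd
  rw [hs.tsum_eq, ← hadd] at hsum
  rw [thetaDenominatorSum, hsum, div_div, div_eq_mul_inv, ← tsum_mul_right]
  refine tsum_congr fun n => ?_
  have e1 := qThetaPair_mul_zpow hq0 hq1 hf hX n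
  have e2 := qThetaPair_mul_zpow hq0 hq1 hg hX n
  have t (k : ℤ) : thetaTerm q (-X ^ 2) k = (q : ℂ) ^ (k * (k - 1) / 2) * X ^ (2 * k) := by
    have h1 : (-1 : ℂ) ^ k * (-1) ^ k = 1 := by rw [← mul_zpow]; simp
    have h2 : (X ^ 2) ^ k = X ^ (2 * k) := by rw [zpow_mul]; rfl
    rw [thetaTerm, ← neg_one_mul (X ^ 2), mul_zpow, h2]
    linear_combination (q : ℂ) ^ (k * (k - 1) / 2) * X ^ (2 * k) * h1
  have c1 : 2 * n * (2 * n - 1) / 2 = n ^ 2 + n ^ 2 - n := by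
    have h1 := two_mul_choose_two (2 * n)
    have h2 : 2 * n * (2 * n - 1) = 2 * (n ^ 2 + n ^ 2 - n) := by ring
    lia
  have c2 : (2 * n + 1) * (2 * n + 1 - 1) / 2 = n ^ 2 + n ^ 2 + n := by
    have h1 := two_mul_choose_two (2 * n + 1)
    have h2 : (2 * n + 1) * (2 * n + 1 - 1) = 2 * (n ^ 2 + n ^ 2 + n) := by ring
    lia
  have t1 : thetaTerm q (-X ^ 2) (2 * n)
      = q ^ (n ^ 2) * q ^ (n ^ 2) * ((q : ℂ) ^ n)⁻¹ * (X ^ (2 * n) * X ^ (2 * n)) := by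
    rw [t, c1, zpow_sub₀ hq, zpow_add₀ hq, ← zpow_add₀ hX, div_eq_mul_inv]
    ring_nf
  have t2 : thetaTerm q (-X ^ 2) (2 * n + 1)
      = q ^ (n ^ 2) * q ^ (n ^ 2) * q ^ n * (X ^ (2 * n) * X ^ (2 * n) * X ^ 2) := by
    rw [t, c2, zpow_add₀ hq, zpow_add₀ hq, ← zpow_add₀ hX, ← zpow_natCast X 2, ← zpow_add₀ hX]
    congr 2
    push_cast
    ring
  have hN (Y : ℂ) : numeratorPair q 0 Y = 1 := by simp [numeratorPair, qPoch_zero]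
  have hs2 : ((-1 : ℂ) ^ n) * (-1) ^ n = 1 := by rw [← mul_zpow]; simp
  have h3 : qThetaPair q f X * qThetaPair q g X
      = q ^ (n ^ 2) * q ^ (n ^ 2) * (X ^ (2 * n) * X ^ (2 * n))
        * (qThetaPair q f (X * q ^ n) * qThetaPair q g (X * q ^ n)) := by
    linear_combination (-(qThetaPair q f X * qThetaPair q g X)) * hs2
      - e1 * ((-1) ^ n * qThetaPair q g X)
      - (q : ℂ) ^ (n ^ 2) * X ^ (2 * n) * qThetaPair q f (X * q ^ n) * e2
  rw [qBetaKernel, hN, h3, t1, t2]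
  have hqn := zpow_ne_zero n hq
  have hqn2 := zpow_ne_zero (n ^ 2) hq
  have hXn := zpow_ne_zero (2 * n) hX
  generalize (q : ℂ) ^ n = A at *
  generalize (q : ℂ) ^ (n ^ 2) = B at *
  generalize X ^ (2 * n) = C at *
  generalize qThetaPair q f (X * A) * qThetaPair q g (X * A) = D
  -- At a zero of the denominator both sides are 0, since division by zero gives 0.
  rcases eq_or_ne D 0 with rfl | hD
  · simp
  · field_simp
    ring

theorem qBetaIntegral_zero {q : ℝ} (hq0 : 0 < q) (hq1 : q < 1) {f g : ℂ} (hf : f.im ≠ 0)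
    (hg : g.im ≠ 0) :
    qBetaIntegral q 0 0 0 0 f g
      = ∫ x in (0 : ℝ)..1, thetaDenominatorSum q ((q ^ x : ℝ) : ℂ)
        / (qThetaPair q f ((q ^ x : ℝ) : ℂ) * qThetaPair q g ((q ^ x : ℝ) : ℂ)) := by
  have hf0 : f ≠ 0 := by rintro rfl; simp at hf
  have hg0 : g ≠ 0 := by rintro rfl; simp at hg
  rw [qBetaIntegral, integral_eq_intervalIntegral_tsum
    (integrable_qBetaKernel hq0 hq1 (by simp) hf hg)]
  congr 1
  funext x
  rw [← tsum_qBetaKernel_zero hq0 hq1 hf0 hg0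
    (by exact_mod_cast (Real.rpow_pos_of_pos hq0 x).ne')]
  refine tsum_congr fun n => ?_
  rw [Real.rpow_add_intCast hq0.ne']
  push_cast
  rfl

theorem continuous_thetaDenominatorSum {q : ℝ} (hq0 : 0 < q) (hq1 : q < 1) :
    Continuous fun x : ℝ => thetaDenominatorSum q ((q ^ x : ℝ) : ℂ) := by
  have hc : Continuous fun x : ℝ => ((q ^ x : ℝ) : ℂ) :=
    Complex.continuous_ofReal.comp (Real.continuous_const_rpow hq0.ne')
  have hX (x : ℝ) : ((q ^ x : ℝ) : ℂ) ≠ 0 := by exact_mod_cast (Real.rpow_pos_of_pos hq0 x).ne'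
  have h := continuous_qPoch hq0 hq1
  have h2 : Continuous fun x : ℝ => -((q ^ x : ℝ) : ℂ) ^ 2 := (hc.pow 2).neg
  have h3 : Continuous fun x : ℝ => (q : ℂ) / (-((q ^ x : ℝ) : ℂ) ^ 2) :=
    continuous_const.div h2 fun x => neg_ne_zero.mpr (pow_ne_zero 2 (hX x))
  exact (continuous_const.mul ((h.comp h2).mul (h.comp h3))).div hc hX

/-! ### Continuous logarithms and their change over a period. -/

/-- The first N factors are never real, since Im c ≠ 0, and the tail (c q^(x+N); q)_∞ stays in the
right half-plane. Principal logarithms of these pieces are therefore smooth in x, and l(0) - l(1)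
telescopes. -/
theorem exists_log_qPoch {q : ℝ} (hq0 : 0 < q) (hq1 : q < 1) {c : ℂ} (hc : c.im ≠ 0) :
    ∃ l : ℝ → ℂ, (∀ x, -1 < x → DifferentiableAt ℝ l x) ∧
      (∀ x, -1 < x → Complex.exp (l x) = qPoch q (c * ((q ^ x : ℝ) : ℂ))) ∧
      l 0 - l 1 = Complex.log (1 - c) := by
  have hn : ‖(q : ℂ)‖ < 1 := by
    rwa [Complex.norm_real, Real.norm_eq_abs, abs_of_pos hq0]
  have hX (x : ℝ) : 0 < q ^ x := Real.rpow_pos_of_pos hq0 x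
  -- The second condition ensures log(uv) = log u + log v when one further factor is split off the
  -- tail.
  have hev : ∀ᶠ a in 𝓝 (0 : ℂ), 0 < (qPoch q a).re ∧ 0 < (1 - a).re := by
    have h1 : ContinuousAt (fun a => (qPoch q a).re) 0 :=
      (Complex.continuous_re.comp (continuous_qPoch hq0 hq1)).continuousAt
    have h2 : ContinuousAt (fun a : ℂ => (1 - a).re) 0 := by fun_prop
    exact (h1.eventually_const_lt (by simp [qPoch_zero])).and
      (h2.eventually_const_lt (by simp))
  obtain ⟨δ, hδ, hball⟩ := Metric.eventually_nhds_iff.mp hev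
  have ht : Tendsto (fun N : ℕ => ‖c‖ * q⁻¹ * q ^ N) atTop (𝓝 0) := by
    simpa using (tendsto_pow_atTop_nhds_zero_of_lt_one hq0.le hq1).const_mul (‖c‖ * q⁻¹)
  obtain ⟨N, hN⟩ := (ht.eventually_lt_const hδ).exists
  have hsmall (x : ℝ) (hx : -1 < x) : dist (c * ((q ^ x : ℝ) : ℂ) * (q : ℂ) ^ N) 0 < δ := by
    rw [dist_zero_right, norm_mul, norm_mul, norm_pow, Complex.norm_real, Complex.norm_real,
      Real.norm_of_nonneg hq0.le, Real.norm_of_nonneg (hX x).le]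
    refine lt_of_le_of_lt ?_ hN
    have h1 : q ^ x ≤ q⁻¹ := by
      rw [← Real.rpow_neg_one]
      exact Real.rpow_le_rpow_of_exponent_ge hq0 hq1.le hx.le
    gcongr
  have him (x : ℝ) (n : ℕ) : (1 - c * ((q ^ x : ℝ) : ℂ) * (q : ℂ) ^ n).im ≠ 0 := by
    rw [← Complex.ofReal_pow, mul_assoc, ← Complex.ofReal_mul, Complex.sub_im, Complex.one_im,
      Complex.im_mul_ofReal, zero_sub]
    exact neg_ne_zero.mpr (mul_ne_zero hc (mul_pos (hX x) (pow_pos hq0 n)).ne')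
  have hd (x : ℝ) (k : ℂ) : DifferentiableAt ℝ (fun y : ℝ => c * ((q ^ y : ℝ) : ℂ) * k) x :=
    ((hasDerivAt_ofReal_rpow hq0 x).differentiableAt.const_mul c).mul_const k
  refine ⟨fun x => (∑ n ∈ Finset.range N, Complex.log (1 - c * ((q ^ x : ℝ) : ℂ) * (q : ℂ) ^ n))
    + Complex.log (qPoch q (c * ((q ^ x : ℝ) : ℂ) * (q : ℂ) ^ N)), ?_, ?_, ?_⟩
  · intro x hx
    refine DifferentiableAt.add (DifferentiableAt.fun_sum fun n _ => ?_) ?_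
    · exact (((hd x _).const_sub 1).hasDerivAt.clog_real (Or.inr (him x n))).differentiableAt
    · refine (HasDerivAt.clog_real (DifferentiableAt.hasDerivAt ?_)
        (Or.inl (hball (hsmall x hx)).1)).differentiableAt
      exact (((differentiable_qPoch hq0 hq1) _).restrictScalars ℝ).comp x (hd x _)
  · intro x hx
    have h1 : qPoch q (c * ((q ^ x : ℝ) : ℂ) * (q : ℂ) ^ N) ≠ 0 := by
      intro h0
      have := (hball (hsmall x hx)).1
      simp [h0] at this
    rw [Complex.exp_add, Complex.exp_log h1, Complex.exp_sum,
      qPoch_eq_prod_mul hq0 hq1 (c * ((q ^ x : ℝ) : ℂ)) N]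
    congr 1
    refine Finset.prod_congr rfl fun n _ => Complex.exp_log fun h0 => him x n ?_
    rw [h0, Complex.zero_im]
  · have s0 := hball (hsmall 0 (by norm_num))
    have s1 := hball (hsmall 1 (by norm_num))
    simp only [Real.rpow_zero, Real.rpow_one, Complex.ofReal_one, mul_one] at s0 s1 ⊢
    have e (n : ℕ) : c * (q : ℂ) * (q : ℂ) ^ n = c * (q : ℂ) ^ (n + 1) := by rw [pow_succ']; ring
    simp only [e] at s1 ⊢
    have h1 : Complex.log (qPoch q (c * (q : ℂ) ^ N))
        = Complex.log (1 - c * (q : ℂ) ^ N) + Complex.log (qPoch q (c * (q : ℂ) ^ (N + 1))) := by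
      have a1 := abs_lt.mp (Complex.abs_arg_lt_pi_div_two_iff.mpr (Or.inl s0.2))
      have a2 := abs_lt.mp (Complex.abs_arg_lt_pi_div_two_iff.mpr (Or.inl s1.1))
      rw [qPoch_eq_mul hq0 hq1, mul_assoc, ← pow_succ, Complex.log_mul]
      · intro h0
        simp [h0] at s0
      · intro h0
        simp [h0] at s1
      · constructor <;> linarith
    have h2 := Finset.sum_range_sub' (fun n => Complex.log (1 - c * (q : ℂ) ^ n)) N
    rw [Finset.sum_sub_distrib] at h2
    rw [pow_zero, mul_one] at h2
    linear_combination h1 + h2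

/-- The two arguments have opposite signs, so their sum does not leave (-π, π]. -/
theorem Complex.log_mul_of_im_mul_im_neg {x y : ℂ} (h : x.im * y.im < 0) :
    Complex.log (x * y) = Complex.log x + Complex.log y := by
  have hx : x ≠ 0 := by rintro rfl; simp at h
  have hy : y ≠ 0 := by rintro rfl; simp at h
  have key {u v : ℂ} (hu : 0 < u.im) (hv : v.im < 0) :
      u.arg + v.arg ∈ Set.Ioc (-Real.pi) Real.pi := by
    have h1 := Complex.arg_nonneg_iff.mpr hu.le
    have h2 := Complex.arg_neg_iff.mpr hv
    have h3 := Complex.neg_pi_lt_arg v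
    have h4 := Complex.arg_le_pi u
    constructor <;> linarith
  rcases mul_neg_iff.mp h with ⟨h1, h2⟩ | ⟨h1, h2⟩
  · exact Complex.log_mul hx hy (key h1 h2)
  · exact Complex.log_mul hx hy (add_comm y.arg x.arg ▸ key h2 h1)

/-- `πi` if `Im f > 0` and `-πi` otherwise. -/
noncomputable def halfTurn (f : ℂ) : ℂ :=
  if 0 < f.im then Real.pi * Complex.I else -(Real.pi * Complex.I)

theorem log_neg_eq_sub_halfTurn {f : ℂ} (hf : f.im ≠ 0) :
    Complex.log (-f) = Complex.log f - halfTurn f := by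
  rcases lt_or_gt_of_ne hf with h | h
  · rw [halfTurn, if_neg h.not_gt, Complex.log, Complex.log, norm_neg,
      Complex.arg_neg_eq_arg_add_pi_of_im_neg h]
    push_cast
    ring
  · rw [halfTurn, if_pos h, Complex.log, Complex.log, norm_neg,
      Complex.arg_neg_eq_arg_sub_pi_of_im_pos h]
    push_cast
    ring

theorem im_mul_inv_im_neg {w : ℂ} (hw : w.im ≠ 0) : w.im * (w⁻¹).im < 0 := by
  have h0 : w ≠ 0 := by rintro rfl; simp at hw
  have h1 := Complex.normSq_pos.mpr h0
  have h2 := mul_self_pos.mpr hw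
  rw [Complex.inv_im, mul_div_assoc', mul_neg, neg_div]
  exact neg_neg_of_pos (div_pos h2 h1)

theorem log_one_add_eq {w : ℂ} (hw : w.im ≠ 0) :
    Complex.log (1 + w) = Complex.log w + Complex.log (1 + w⁻¹) := by
  have h0 : w ≠ 0 := by rintro rfl; simp at hw
  rw [← Complex.log_mul_of_im_mul_im_neg]
  · congr 1
    field_simp
    ring
  · simpa using im_mul_inv_im_neg hw

/-- The factors in 1/X are written with q^(1-x), so their logarithms run backwards. The four
increments combine through log(1+w) = log w + log(1+1/w) into log(-f/q) - log f; here the sign of Im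
f enters. -/
theorem exists_log_qThetaPair {q : ℝ} (hq0 : 0 < q) (hq1 : q < 1) {f : ℂ} (hf : f.im ≠ 0) :
    ∃ L : ℝ → ℂ, (∀ x ∈ Set.Ioo (-1 : ℝ) 2, DifferentiableAt ℝ L x) ∧
      (∀ x ∈ Set.Ioo (-1 : ℝ) 2, Complex.exp (L x) = qThetaPair q f ((q ^ x : ℝ) : ℂ)) ∧
      L 1 - L 0 = -((Real.log q : ℝ) : ℂ) - halfTurn f := by
  have hq : (q : ℂ) ≠ 0 := by exact_mod_cast hq0.ne'
  have hf0 : f ≠ 0 := by rintro rfl; simp at hf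
  have hX (x : ℝ) : ((q ^ x : ℝ) : ℂ) ≠ 0 := by exact_mod_cast (Real.rpow_pos_of_pos hq0 x).ne'
  have i0 : f⁻¹.im ≠ 0 := fun h => by simpa [h] using im_mul_inv_im_neg hf
  have i1 : (f / q).im ≠ 0 := by
    rw [Complex.div_ofReal_im]
    exact div_ne_zero hf hq0.ne'
  have i2 : (q / f).im ≠ 0 := by
    rw [div_eq_mul_inv, Complex.im_ofReal_mul]
    exact mul_ne_zero hq0.ne' i0
  obtain ⟨l₁, d₁, e₁, v₁⟩ := exists_log_qPoch hq0 hq1 i1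
  obtain ⟨l₂, d₂, e₂, v₂⟩ := exists_log_qPoch hq0 hq1 i2
  obtain ⟨l₃, d₃, e₃, v₃⟩ := exists_log_qPoch hq0 hq1 (c := -f) (by simpa using hf)
  obtain ⟨l₄, d₄, e₄, v₄⟩ := exists_log_qPoch hq0 hq1 (c := -f⁻¹) (by
    rw [Complex.neg_im]
    exact neg_ne_zero.mpr i0)
  refine ⟨fun x => l₁ (1 - x) + l₂ x + l₃ x + l₄ (1 - x), fun x hx => ?_, fun x hx => ?_, ?_⟩
  · have hs : DifferentiableAt ℝ (fun y : ℝ => 1 - y) x := by fun_prop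
    have h1 : -1 < 1 - x := by linarith [hx.2]
    exact ((((d₁ _ h1).comp x hs).add (d₂ x hx.1)).add (d₃ x hx.1)).add ((d₄ _ h1).comp x hs)
  · have h1 : -1 < 1 - x := by linarith [hx.2]
    rw [Complex.exp_add, Complex.exp_add, Complex.exp_add, e₁ _ h1, e₂ x hx.1, e₃ x hx.1, e₄ _ h1,
      Real.rpow_sub hq0, Real.rpow_one, qThetaPair, qTheta, qTheta, Complex.ofReal_div]
    have hx0 := hX x
    have a1 : f / (q : ℂ) * (q / ((q ^ x : ℝ) : ℂ)) = f / ((q ^ x : ℝ) : ℂ) := by field_simp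
    have a2 : (q : ℂ) / f * ((q ^ x : ℝ) : ℂ) = q / (f / ((q ^ x : ℝ) : ℂ)) := by field_simp
    have a4 : -f⁻¹ * (q / ((q ^ x : ℝ) : ℂ)) = q / (-(f * ((q ^ x : ℝ) : ℂ))) := by
      rw [div_neg]
      field_simp
    rw [a1, a2, a4, neg_mul]
    ring
  · have b1 := log_one_add_eq (w := -(f / q)) (by rw [Complex.neg_im]; exact neg_ne_zero.mpr i1)
    have b2 := log_one_add_eq hf
    have b3 := log_neg_eq_sub_halfTurn i1
    have b4 : Complex.log (f / q) = Complex.log f - ((Real.log q : ℝ) : ℂ) := by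
      have h := Complex.log_ofReal_mul (inv_pos.mpr hq0) hf0
      rw [Real.log_inv, Complex.ofReal_neg, Complex.ofReal_inv] at h
      rw [div_eq_inv_mul, h]
      ring
    have b5 : halfTurn (f / q) = halfTurn f := by
      rw [halfTurn, halfTurn, Complex.div_ofReal_im]
      simp only [div_pos_iff_of_pos_right hq0]
    rw [inv_neg, inv_div, ← sub_eq_add_neg, ← sub_eq_add_neg] at b1
    rw [sub_neg_eq_add] at v₃ v₄
    simp only [sub_self, sub_zero]
    rw [b5] at b3
    linear_combination v₁ - v₂ - v₃ + v₄ + b1 - b2 + b3 + b4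

/-! ### The value of the parameter-free integral. -/

theorem halfTurn_sub_eq_mul_qBetaIntegral {q : ℝ} (hq0 : 0 < q) (hq1 : q < 1) {f g : ℂ}
    (hf : f.im ≠ 0) (hg : g.im ≠ 0) :
    -(f * ((Real.log q : ℝ) : ℂ) * qPoch q q * qThetaPair q g f) * qBetaIntegral q 0 0 0 0 f g
      = halfTurn f - halfTurn g := by
  have hf0 : f ≠ 0 := by rintro rfl; simp at hf
  have hg0 : g ≠ 0 := by rintro rfl; simp at hg
  have hX (x : ℝ) : 0 < q ^ x := Real.rpow_pos_of_pos hq0 x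
  have key {t : ℂ} (ht : t.im ≠ 0) {L : ℝ → ℂ}
      (hd : ∀ x ∈ Set.Ioo (-1 : ℝ) 2, DifferentiableAt ℝ L x)
      (he : ∀ x ∈ Set.Ioo (-1 : ℝ) 2, Complex.exp (L x) = qThetaPair q t ((q ^ x : ℝ) : ℂ))
      {x : ℝ} (hx : x ∈ Set.Ioo (-1 : ℝ) 2) :
      HasDerivAt L (deriv (fun y : ℝ => qThetaPair q t ((q ^ y : ℝ) : ℂ)) x
        / qThetaPair q t ((q ^ x : ℝ) : ℂ)) x := by
    have h1 := (hd x hx).hasDerivAt.cexp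
    have h2 : (fun y => Complex.exp (L y)) =ᶠ[𝓝 x]
        fun y : ℝ => qThetaPair q t ((q ^ y : ℝ) : ℂ) := by
      filter_upwards [Ioo_mem_nhds hx.1 hx.2] with y hy using he y hy
    have h3 := h2.deriv_eq
    rw [h1.deriv, he x hx] at h3
    rw [← h3, mul_div_cancel_left₀ _ (qThetaPair_ne_zero hq0 hq1 ht (hX x))]
    exact (hd x hx).hasDerivAt
  obtain ⟨Lf, df, ef, vf⟩ := exists_log_qThetaPair hq0 hq1 hf
  obtain ⟨Lg, dg, eg, vg⟩ := exists_log_qThetaPair hq0 hq1 hg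
  rw [qBetaIntegral_zero hq0 hq1 hf hg, ← intervalIntegral.integral_const_mul,
    intervalIntegral.integral_eq_sub_of_hasDerivAt (f := fun x => Lg x - Lf x)]
  · linear_combination vg - vf
  · intro x hx
    rw [Set.uIcc_of_le zero_le_one] at hx
    have hx2 : x ∈ Set.Ioo (-1 : ℝ) 2 := ⟨by linarith [hx.1], by linarith [hx.2]⟩
    refine ((key hg dg eg hx2).sub (key hf df ef hx2)).congr_deriv ?_
    have hw := wronskian_qThetaPair hq0 hq1 hf0 hg0 x
    have n1 := qThetaPair_ne_zero hq0 hq1 hf (hX x)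
    have n2 := qThetaPair_ne_zero hq0 hq1 hg (hX x)
    rw [thetaDenominatorSum, div_sub_div _ _ n2 n1, ← mul_div_assoc,
      mul_comm (qThetaPair q g ((q ^ x : ℝ) : ℂ)) (qThetaPair q f ((q ^ x : ℝ) : ℂ))]
    congr 1
    linear_combination hw
  · exact ((continuous_div_qThetaPair hq0 hq1 hf hg
      (continuous_thetaDenominatorSum hq0 hq1)).const_mul _).intervalIntegrable _ _

theorem qThetaPair_one_left_ne_zero {q : ℝ} (hq0 : 0 < q) (hq1 : q < 1) {f : ℂ} (hf : f.im ≠ 0) :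
    qThetaPair q 1 f ≠ 0 := by
  refine mul_ne_zero (qTheta_ne_zero_of_im_ne_zero hq0 hq1 fun h => ?_)
    (qTheta_ne_zero_of_im_ne_zero hq0 hq1 (by simpa using hf))
  rw [one_div] at h
  simpa [h] using im_mul_inv_im_neg hf

/-- By the Wronskian with g = 1, a nonzero multiple of the integrand is the derivative of θ_1/θ_f.
This has period 1 because θ_1 and θ_f have the same multiplier. The zeros of θ_1 do no harm in the
numerator. -/
theorem intervalIntegral_div_qThetaPair_sq {q : ℝ} (hq0 : 0 < q) (hq1 : q < 1) {f : ℂ}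
    (hf : f.im ≠ 0) :
    ∫ x in (0 : ℝ)..1, thetaDenominatorSum q ((q ^ x : ℝ) : ℂ)
      / (qThetaPair q f ((q ^ x : ℝ) : ℂ) * qThetaPair q f ((q ^ x : ℝ) : ℂ)) = 0 := by
  have hq : (q : ℂ) ≠ 0 := by exact_mod_cast hq0.ne'
  have hf0 : f ≠ 0 := by rintro rfl; simp at hf
  have hX (x : ℝ) : 0 < q ^ x := Real.rpow_pos_of_pos hq0 x
  have hc : -(f * ((Real.log q : ℝ) : ℂ) * qPoch q q * qThetaPair q 1 f) ≠ 0 := by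
    have hl : ((Real.log q : ℝ) : ℂ) ≠ 0 := by exact_mod_cast (Real.log_neg hq0 hq1).ne
    exact neg_ne_zero.mpr (mul_ne_zero (mul_ne_zero (mul_ne_zero hf0 hl)
      (qPoch_self_ne_zero hq0 hq1)) (qThetaPair_one_left_ne_zero hq0 hq1 hf))
  refine (mul_eq_zero.mp ?_).resolve_left hc
  rw [← intervalIntegral.integral_const_mul, intervalIntegral.integral_eq_sub_of_hasDerivAt
    (f := fun x : ℝ => qThetaPair q 1 ((q ^ x : ℝ) : ℂ) / qThetaPair q f ((q ^ x : ℝ) : ℂ))]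
  · have h1 := qThetaPair_mul hq0 hq1 (f := 1) (X := 1) one_ne_zero one_ne_zero
    have h2 := qThetaPair_mul hq0 hq1 (X := 1) hf0 one_ne_zero
    have n1 := qThetaPair_ne_zero hq0 hq1 hf one_pos
    have n2 := qThetaPair_ne_zero hq0 hq1 hf hq0
    rw [Complex.ofReal_one] at n1
    simp only [one_mul, one_pow, mul_one] at h1 h2
    simp only [Real.rpow_zero, Real.rpow_one, Complex.ofReal_one]
    rw [sub_eq_zero, div_eq_div_iff n2 n1]
    refine mul_left_cancel₀ hq ?_
    linear_combination qThetaPair q f 1 * h1 - qThetaPair q 1 1 * h2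
  · intro x _
    have n1 := qThetaPair_ne_zero hq0 hq1 hf (hX x)
    have hw := wronskian_qThetaPair hq0 hq1 hf0 one_ne_zero x
    refine ((differentiableAt_qThetaPair_rpow hq0 hq1 one_ne_zero x).hasDerivAt.fun_div
      (differentiableAt_qThetaPair_rpow hq0 hq1 hf0 x).hasDerivAt n1).congr_deriv ?_
    rw [thetaDenominatorSum, ← mul_div_assoc, sq]
    congr 1
    linear_combination hw
  · exact ((continuous_div_qThetaPair hq0 hq1 hf hf
      (continuous_thetaDenominatorSum hq0 hq1)).const_mul _).intervalIntegrable _ _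

theorem qBetaIntegral_zero_of_same_sign {q : ℝ} (hq0 : 0 < q) (hq1 : q < 1) {f g : ℂ}
    (h : 0 < f.im * g.im) : qBetaIntegral q 0 0 0 0 f g = 0 := by
  have hf : f.im ≠ 0 := left_ne_zero_of_mul h.ne'
  have hg : g.im ≠ 0 := right_ne_zero_of_mul h.ne'
  have hf0 : f ≠ 0 := by rintro rfl; simp at hf
  have hg0 : g ≠ 0 := by rintro rfl; simp at hg
  have hX (x : ℝ) : 0 < q ^ x := Real.rpow_pos_of_pos hq0 x
  -- If the Wronskian constant vanishes, the logarithmic primitive says nothing; the three-term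
  -- relation then makes θ_g a multiple of θ_f.
  rcases eq_or_ne (qThetaPair q g f) 0 with h0 | h0
  · have n1 := qThetaPair_ne_zero hq0 hq1 hf one_pos
    rw [Complex.ofReal_one] at n1
    have hr (x : ℝ) : qThetaPair q g ((q ^ x : ℝ) : ℂ)
        = qThetaPair q g 1 / qThetaPair q f 1 * qThetaPair q f ((q ^ x : ℝ) : ℂ) := by
      have h1 := qThetaPair_three_term hq0 hq1 hf0 hg0 one_ne_zero
        (Z := ((q ^ x : ℝ) : ℂ)) (by exact_mod_cast (hX x).ne')
      rw [h0] at h1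
      rw [div_mul_eq_mul_div, eq_div_iff n1]
      linear_combination h1
    rw [qBetaIntegral_zero hq0 hq1 hf hg]
    have e (x : ℝ) : thetaDenominatorSum q ((q ^ x : ℝ) : ℂ)
        / (qThetaPair q f ((q ^ x : ℝ) : ℂ) * qThetaPair q g ((q ^ x : ℝ) : ℂ))
        = (qThetaPair q g 1 / qThetaPair q f 1)⁻¹ * (thetaDenominatorSum q ((q ^ x : ℝ) : ℂ)
        / (qThetaPair q f ((q ^ x : ℝ) : ℂ) * qThetaPair q f ((q ^ x : ℝ) : ℂ))) := by
      rw [hr x, mul_left_comm, div_mul_eq_div_div_swap, div_eq_inv_mul _ (_ / _)]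
    simp_rw [e]
    rw [intervalIntegral.integral_const_mul, intervalIntegral_div_qThetaPair_sq hq0 hq1 hf,
      mul_zero]
  · have h1 := halfTurn_sub_eq_mul_qBetaIntegral hq0 hq1 hf hg
    have h2 : halfTurn f - halfTurn g = 0 := by
      rcases pos_and_pos_or_neg_and_neg_of_mul_pos h with ⟨h3, h4⟩ | ⟨h3, h4⟩
      · simp [halfTurn, h3, h4]
      · simp [halfTurn, h3.not_gt, h4.not_gt]
    have hl : ((Real.log q : ℝ) : ℂ) ≠ 0 := by exact_mod_cast (Real.log_neg hq0 hq1).ne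
    rw [h2] at h1
    exact (mul_eq_zero.mp h1).resolve_left (neg_ne_zero.mpr (mul_ne_zero (mul_ne_zero
      (mul_ne_zero hf0 hl) (qPoch_self_ne_zero hq0 hq1)) h0))

/-! ### Nonvanishing of the closed form's denominator, and conclusion. -/

/-- A vanishing factor would make g a positive multiple of f, or -fg a positive real. In the second
case -f is a positive multiple of 1/g. Either way Im f and Im g would have the same sign. -/
theorem qThetaPair_ne_zero_of_opposite_sign {q : ℝ} (hq0 : 0 < q) (hq1 : q < 1) {f g : ℂ}
    (h : f.im * g.im < 0) : qThetaPair q g f ≠ 0 := by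
  have hf0 : f ≠ 0 := by rintro rfl; simp at h
  have hg0 : g ≠ 0 := by rintro rfl; simp at h
  have k1 {u v : ℂ} (huv : u.im * v.im < 0) {s : ℝ} (hs : 0 < s) : v * s ≠ u := by
    rintro rfl
    rw [Complex.im_mul_ofReal] at huv
    nlinarith [mul_nonneg hs.le (mul_self_nonneg v.im)]
  have k2 {s : ℝ} (hs : 0 < s) : -(g * f) ≠ s := by
    intro h1
    have h2 : g⁻¹ * (s : ℂ) = -f := by
      rw [← h1]
      field_simp
    refine k1 (u := -f) (v := g⁻¹) ?_ hs h2
    have h3 := im_mul_inv_im_neg (right_ne_zero_of_mul h.ne)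
    rw [Complex.neg_im]
    by_contra hcon
    nlinarith [mul_pos_of_neg_of_neg h h3, mul_self_nonneg g.im]
  have hp (n : ℕ) : 0 < q ^ n := pow_pos hq0 n
  refine mul_ne_zero (mul_ne_zero ?_ ?_) (mul_ne_zero ?_ ?_) <;>
    refine qPoch_ne_zero hq0 hq1 fun n h1 => ?_
  · refine k1 h (hp n) ?_
    push_cast
    field_simp at h1
    linear_combination -h1
  · refine k1 (u := g) (v := f) (by linarith [mul_comm f.im g.im]) (hp (n + 1)) ?_
    push_cast
    rw [div_div_eq_mul_div] at h1
    field_simp at h1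
    rw [pow_succ]
    linear_combination -h1
  · refine k2 (inv_pos.mpr (hp n)) ?_
    push_cast
    exact eq_inv_of_mul_eq_one_left (by linear_combination -h1)
  · refine k2 (hp (n + 1)) ?_
    have h2 : -(g * f) ≠ 0 := neg_ne_zero.mpr (mul_ne_zero hg0 hf0)
    rw [div_mul_eq_mul_div, sub_eq_zero, eq_div_iff h2] at h1
    push_cast
    rw [pow_succ]
    linear_combination h1

theorem qBetaValue_denominator_eq (q : ℝ) (a b c d f g : ℂ) :
    qPochs q [(q : ℂ), g / f, q * f / g, -(f * g), -(q / (f * g)), a * b * c * d / (q : ℂ) ^ 3]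
      = qPoch q q * qThetaPair q g f * qPoch q (a * b * c * d / (q : ℂ) ^ 3) := by
  simp only [qPochs, List.map_cons, List.map_nil, List.prod_cons, List.prod_nil, qThetaPair, qTheta]
  rw [div_div_eq_mul_div, div_neg, mul_comm g f]
  ring

theorem mainTheorem2 (q : ℝ) (hq0 : 0 < q) (hq1 : q < 1) (a b c d f g : ℂ)
    (habcd : ‖a * b * c * d / (q : ℂ) ^ 3‖ < 1) (hf : f.im ≠ 0) (hg : g.im ≠ 0) :
    (∀ x : ℝ, ∀ t ∈ [f, g],
      qPochs q [t * ((q ^ (-x) : ℝ) : ℂ), q * ((q ^ x : ℝ) : ℂ) / t,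
        -(t * ((q ^ x : ℝ) : ℂ)), -(q * ((q ^ (-x) : ℝ) : ℂ) / t)] ≠ 0) ∧
    Integrable (qBetaIntegrand q a b c d f g) volume ∧
    (f.im * g.im < 0 →
      f * ((Real.log q⁻¹ : ℝ) : ℂ)
        * qPochs q [(q : ℂ), g / f, q * f / g, -(f * g), -(q / (f * g)),
            a * b * c * d / (q : ℂ) ^ 3] ≠ 0) ∧
    (0 < f.im → g.im < 0 →
      ∫ x : ℝ, qBetaIntegrand q a b c d f g x = qBetaValue q a b c d f g) ∧
    (f.im < 0 → 0 < g.im →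
      ∫ x : ℝ, qBetaIntegrand q a b c d f g x = -qBetaValue q a b c d f g) ∧
    (0 < f.im * g.im →
      ∫ x : ℝ, qBetaIntegrand q a b c d f g x = 0) := by
  have hf0 : f ≠ 0 := by rintro rfl; simp at hf
  have hint : qBetaIntegrand q a b c d f g
      = fun x => qBetaKernel q a b c d f g ((q ^ x : ℝ) : ℂ) :=
    funext (qBetaIntegrand_eq hq0 a b c d f g)
  have hI : ∫ x : ℝ, qBetaIntegrand q a b c d f g x = qBetaIntegral q a b c d f g := by
    rw [hint, qBetaIntegral]
  have hP := qPoch_ne_zero_of_norm_lt_one hq0 hq1 habcd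
  have hred := qBetaIntegral_eq hq0 hq1 habcd hf hg
  have hden (h : f.im * g.im < 0) : f * ((Real.log q⁻¹ : ℝ) : ℂ)
        * qPochs q [(q : ℂ), g / f, q * f / g, -(f * g), -(q / (f * g)),
            a * b * c * d / (q : ℂ) ^ 3] ≠ 0 := by
    have hl : ((Real.log q⁻¹ : ℝ) : ℂ) ≠ 0 := by
      rw [Real.log_inv]
      exact_mod_cast (neg_pos.mpr (Real.log_neg hq0 hq1)).ne'
    rw [qBetaValue_denominator_eq]
    exact mul_ne_zero (mul_ne_zero hf0 hl) (mul_ne_zero (mul_ne_zero (qPoch_self_ne_zero hq0 hq1)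
      (qThetaPair_ne_zero_of_opposite_sign hq0 hq1 h)) hP)
  -- Both opposite-sign cases follow at once, since the difference of half turns is 2πi or -2πi.
  have hval (h : f.im * g.im < 0) : 2 * Real.pi * Complex.I * qBetaIntegral q a b c d f g
      = (halfTurn f - halfTurn g) * qBetaValue q a b c d f g := by
    have h1 := halfTurn_sub_eq_mul_qBetaIntegral hq0 hq1 hf hg
    have h2 := hden h
    rw [qBetaValue, mul_div_assoc', eq_div_iff h2, qBetaValue_denominator_eq, Real.log_inv,
      Complex.ofReal_neg, ← h1]
    simp only [qPochs, List.map_cons, List.map_nil, List.prod_cons, List.prod_nil]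
    linear_combination (-(2 * Real.pi * Complex.I * f * ((Real.log q : ℝ) : ℂ) * qPoch q q
      * qThetaPair q g f)) * hred
  have hpi : (2 * Real.pi * Complex.I : ℂ) ≠ 0 := Complex.two_pi_I_ne_zero
  refine ⟨fun x t ht => ?_, ?_, hden, fun h1 h2 => ?_, fun h1 h2 => ?_, fun h => ?_⟩
  · rw [qPochs_eq_qThetaPair hq0]
    have ht2 : t.im ≠ 0 := by
      simp only [List.mem_cons, List.not_mem_nil, or_false] at ht
      rcases ht with rfl | rfl <;> assumption
    exact qThetaPair_ne_zero hq0 hq1 ht2 (Real.rpow_pos_of_pos hq0 x)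
  · rw [hint]
    exact integrable_qBetaKernel hq0 hq1 habcd hf hg
  · have h3 := hval (mul_neg_of_pos_of_neg h1 h2)
    rw [halfTurn, halfTurn, if_pos h1, if_neg h2.not_gt] at h3
    rw [hI]
    refine mul_left_cancel₀ hpi ?_
    linear_combination h3
  · have h3 := hval (mul_neg_of_neg_of_pos h1 h2)
    rw [halfTurn, halfTurn, if_pos h2, if_neg h1.not_gt] at h3
    rw [hI]
    refine mul_left_cancel₀ hpi ?_
    linear_combination h3
  · rw [hI]
    rw [qBetaIntegral_zero_of_same_sign hq0 hq1 h, mul_zero] at hred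
    exact (mul_eq_zero.mp hred).resolve_left hP
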